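/- Let $K$ be a commutative ring. An \emph{acceptable commutative pro-algebra} over $K$ is a functor $A=\{A_i\}\colon I^{\mathrm{op}}\to\{\text{commutative }K\text{-algebras}\}$, where $I$ is a nonempty directed poset with a countable cofinal subset and all transition maps $A_j\to A_i$ ($i\le j$) are surjective. Morphisms between pro-algebras $A=\{A_i\}_{i\in I}$ and $B=\{B_j\}_{j\in J}$ (the index posets may vary) are $\hom(A,B)=\varprojlim_j\varinjlim_i\hom(A_i,B_j)$. Let $\varprojlim_i\mathcal M_{A_i}$ be the limit, along extension of scalars, of the module categories: its objects are families of $A_i$-modules $M_i$ with compatible isomorphisms $A_i\otimes_{A_j}M_j\cong M_i$ for $i\le j$, with the componentwise tensor product. For symmetric monoidal locally presentable $K$-linear categories $\mathcal C,\mathcal D$ (the tensor product being $K$-linear and cocontinuous in each variable), let $\operatorname{Hom}_\otimes(\mathcal C,\mathcal D)$ be the category of cocontinuous symmetric monoidal $K$-linear functors and symmetric monoidal natural transformations. For every acceptable commutative pro-algebra $A$, the category $\varprojlim_i\mathcal M_{A_i}$ is a symmetric monoidal locally presentable $K$-linear category. Every morphism $\varphi\colon A\to B$ of acceptable commutative pro-algebras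 has an inverse image functor $\varphi^*\in\operatorname{Hom}_\otimes(\varprojlim_i\mathcal M_{A_i},\varprojlim_j\mathcal M_{B_j})$, that is, a functor equipped with symmetric monoidal natural isomorphisms $(\varphi^*M)_j\cong B_j\otimes_{A_i}M_i$ for all representatives $A_i\to B_j$ of the $j$-th component of $\varphi$, compatible with the transition maps in $i$ and in $j$. These are compatible with identities and composition: the identity functor is an inverse image functor along $\mathrm{id}_A$, and $\psi^*\circ\varphi^*$ is one along $\psi\circ\varphi$. The resulting functor $\{A_i\}\mapsto\varprojlim_i\mathcal M_{A_i}$ is fully faithful: for all acceptable commutative pro-algebras $A$ and $B$ the functor $$\hom(A,B)\longrightarrow \operatorname{Hom}_\otimes\Bigl(\varprojlim_i\mathcal M_{A_i},\ \varprojlim_j\mathcal M_{B_j}\Bigr),\qquad \varphi\mapsto\varphi^*,$$ from the set $\hom(A,B)$, regarded as a discrete category, is an equivalence of categories (for any choice of the inverse image functors $\varphi^*$). Moreover, for every such $A$ the affine ind-scheme $\varinjlim_i\operatorname{Spec}A_i$ is 2-affine (tensorial): for every commutative $K$-algebra $S$, each element of $\varinjlim_i\hom(A_i,S)$, represented by some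 $A_i\to S$, has an inverse image functor $M\mapsto S\otimes_{A_i}M_i$ in $\operatorname{Hom}_\otimes(\varprojlim_i\mathcal M_{A_i},\mathcal M_S)$, and the functor $\varinjlim_i\hom(A_i,S)\to\operatorname{Hom}_\otimes(\varprojlim_i\mathcal M_{A_i},\mathcal M_S)$ from the discrete category sending an element to its inverse image functor is an equivalence of categories. -/

import Mathlib

open CategoryTheory MonoidalCategory Limits Opposite
open scoped ModuleCat.Algebra ChangeOfRings

universe u

/-! ### Symmetric monoidal locally presentable linear categories and their morphisms -/

section TensorCategories

variable (K : Type u) [CommRing K]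

/-- A symmetric monoidal `K`-linear category is a *symmetric monoidal locally presentable
`K`-linear category* if its underlying category is locally presentable and its tensor product is
`K`-linear and cocontinuous in each variable. -/
structure IsTensorLocallyPresentable (C : Type (u + 1)) [Category.{u} C] [MonoidalCategory C]
    [SymmetricCategory C] [Preadditive C] [Linear K C] : Prop where
  locallyPresentable : IsLocallyPresentable.{u} C
  monoidalPreadditive : MonoidalPreadditive C
  monoidalLinear : MonoidalLinear K C
  cocontinuous_left (X : C) : PreservesColimitsOfSize.{u, u} (tensorLeft X)
  cocontinuous_right (X : C) : PreservesColimitsOfSize.{u, u} (tensorRight X)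

variable (C D : Type (u + 1)) [Category.{u} C] [MonoidalCategory C] [SymmetricCategory C]
  [Preadditive C] [Linear K C] [Category.{u} D] [MonoidalCategory D] [SymmetricCategory D]
  [Preadditive D] [Linear K D]

/-- The lax symmetric monoidal functors `C ⥤ D` that are (strong) symmetric monoidal,
`K`-linear and cocontinuous. -/
def isTensorFunctor : ObjectProperty (LaxBraidedFunctor C D) := fun F =>
  IsIso (Functor.LaxMonoidal.ε F.toFunctor) ∧
  (∀ X Y : C, IsIso (Functor.LaxMonoidal.μ F.toFunctor X Y)) ∧
  F.toFunctor.Additive ∧ Functor.Linear K F.toFunctor ∧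
  PreservesColimitsOfSize.{u, u} F.toFunctor

/-- The category `Hom_⊗(C, D)` of cocontinuous symmetric monoidal `K`-linear functors and
symmetric monoidal natural transformations. -/
abbrev TensorFunctor : Type (u + 1) := (isTensorFunctor K C D).FullSubcategory

variable {K C D}

/-- The functor underlying an object of `Hom_⊗(C, D)`. -/
abbrev TensorFunctor.functor (F : TensorFunctor K C D) : C ⥤ D := F.obj.toFunctor

end TensorCategories

/-! ### The limit of the categories of modules over a diagram of commutative algebras -/

section LimitOfModuleCategories

variable {K : Type u} [CommRing K] {I : Type u} [Category.{u} I]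

/-- For a system `M` of modules over a diagram `R` of commutative rings and `f : X ⟶ Y`, the
`R Y`-linear map `R Y ⊗_{R X} M X ⟶ M Y` induced by the transition map `M X ⟶ M Y`. -/
noncomputable def baseChangeMap {R : Iᵒᵖ ⥤ CommRingCat.{u}}
    (M : PresheafOfModules.{u} (R ⋙ forget₂ CommRingCat.{u} RingCat.{u})) {X Y : Iᵒᵖ} (f : X ⟶ Y) :
    (ModuleCat.extendScalars (R.map f).hom).obj (M.obj X) ⟶ M.obj Y :=
  ((ModuleCat.extendRestrictScalarsAdj (R.map f).hom).homEquiv (M.obj X) (M.obj Y)).symm (M.map f)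

/-- A system of modules is cartesian if all the maps `R Y ⊗_{R X} M X ⟶ M Y` are isomorphisms. -/
def isCartesian (R : Iᵒᵖ ⥤ CommRingCat.{u}) :
    ObjectProperty (PresheafOfModules.{u} (R ⋙ forget₂ CommRingCat.{u} RingCat.{u})) :=
  fun M => ∀ ⦃X Y : Iᵒᵖ⦄ (f : X ⟶ Y), IsIso (baseChangeMap M f)

theorem baseChangeMap_tensor {R : Iᵒᵖ ⥤ CommRingCat.{u}}
    (M N : PresheafOfModules.{u} (R ⋙ forget₂ CommRingCat.{u} RingCat.{u})) {X Y : Iᵒᵖ}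
    (f : X ⟶ Y) :
    baseChangeMap (M ⊗ N) f =
      (Functor.Monoidal.μIso (ModuleCat.extendScalars (R.map f).hom) (M.obj X) (N.obj X)).inv ≫
      MonoidalCategory.tensorHom (C := ModuleCat (R.obj Y))
        (baseChangeMap M f) (baseChangeMap N f) := by
  apply ((ModuleCat.extendRestrictScalarsAdj (R.map f).hom).homEquiv _ _).injective
  rw [baseChangeMap, Equiv.apply_symm_apply]
  have h : ∀ (P : PresheafOfModules.{u} (R ⋙ forget₂ CommRingCat.{u} RingCat.{u}))
      (m : P.obj X),
      letI := (R.map f).hom.toAlgebra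
      (baseChangeMap P f).hom ((1 : R.obj Y) ⊗ₜ[R.obj X] m) = (P.map f).hom m := by
    intro P m
    have := ModuleCat.extendRestrictScalarsAdj_homEquiv_apply (baseChangeMap P f) m
    rw [baseChangeMap, Equiv.apply_symm_apply] at this
    exact this.symm
  refine ModuleCat.MonoidalCategory.tensor_ext (fun m n => ?_)
  refine Eq.trans ?_ (congrArg₂ (fun a b => a ⊗ₜ[R.obj Y] b) (h M m) (h N n)).symm
  rfl

theorem baseChangeMap_unit {R : Iᵒᵖ ⥤ CommRingCat.{u}} {X Y : Iᵒᵖ} (f : X ⟶ Y) :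
    baseChangeMap (𝟙_ (PresheafOfModules.{u} (R ⋙ forget₂ CommRingCat.{u} RingCat.{u}))) f =
      (Functor.Monoidal.εIso (ModuleCat.extendScalars (R.map f).hom)).inv := by
  apply ((ModuleCat.extendRestrictScalarsAdj (R.map f).hom).homEquiv _ _).injective
  rw [baseChangeMap, Equiv.apply_symm_apply]
  ext
  change (R.map f).hom 1 = (R.map f).hom 1 • (1 : R.obj Y)
  simp

/-- Cartesian systems contain the unit and are stable under the componentwise tensor product. -/
instance isCartesian_isMonoidal (R : Iᵒᵖ ⥤ CommRingCat.{u}) : (isCartesian R).IsMonoidal where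
  prop_unit X Y f := by
    rw [baseChangeMap_unit]
    exact Iso.isIso_inv _
  prop_tensor M N hM hN X Y f := by
    have := hM f
    have := hN f
    rw [baseChangeMap_tensor]
    have h := Iso.isIso_inv
      (Functor.Monoidal.μIso (ModuleCat.extendScalars (R.map f).hom) (M.obj X) (N.obj X))
    exact IsIso.comp_isIso' h (Iso.isIso_hom (C := ModuleCat (R.obj Y))
      (tensorIso (C := ModuleCat (R.obj Y)) (asIso (baseChangeMap M f)) (asIso (baseChangeMap N f))))

/-- Systems of modules `M i` over the algebras `A i`, with (not necessarily cartesian)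
transition maps. -/
abbrev ModuleSystem (A : Iᵒᵖ ⥤ CommAlgCat.{u} K) : Type (u + 1) :=
  PresheafOfModules.{u}
    ((A ⋙ forget₂ (CommAlgCat.{u} K) CommRingCat.{u}) ⋙ forget₂ CommRingCat.{u} RingCat.{u})

/-- The `i`-th component of a system of modules. -/
abbrev ModuleSystem.eval (A : Iᵒᵖ ⥤ CommAlgCat.{u} K) (i : Iᵒᵖ) :
    ModuleSystem A ⥤ ModuleCat.{u} (A.obj i) :=
  PresheafOfModules.evaluation _ i

/-- Scalars in `K` act on morphisms of systems of modules componentwise. -/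
noncomputable instance ModuleSystem.linear (A : Iᵒᵖ ⥤ CommAlgCat.{u} K) :
    Linear K (ModuleSystem A) where
  homModule M N :=
    { smul c f :=
        { app X := (show (eval A X).obj M ⟶ (eval A X).obj N from c • (eval A X).map f)
          naturality {X Y} g := by
            ext m
            have h1 := PresheafOfModules.naturality_apply f g m
            have h2 := PresheafOfModules.map_smul N g (algebraMap K (A.obj X) c) (f.app X m)
            have h3 : (A.map g).hom (algebraMap K (A.obj X) c) = algebraMap K (A.obj Y) c :=
              (A.map g).hom.commutes c
            change algebraMap K (A.obj Y) c • f.app Y (M.map g m) =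
              N.map g (algebraMap K (A.obj X) c • f.app X m)
            rw [h1]
            refine Eq.trans ?_ h2.symm
            exact congrArg (· • N.map g (f.app X m)) h3.symm }
      one_smul f := PresheafOfModules.hom_ext fun X => one_smul K ((eval A X).map f)
      mul_smul a b f := PresheafOfModules.hom_ext fun X => mul_smul a b ((eval A X).map f)
      smul_zero a := PresheafOfModules.hom_ext fun X =>
        smul_zero (A := (eval A X).obj M ⟶ (eval A X).obj N) a
      smul_add a f g := PresheafOfModules.hom_ext fun X =>
        smul_add a ((eval A X).map f) ((eval A X).map g)
      add_smul a b f := PresheafOfModules.hom_ext fun X => add_smul a b ((eval A X).map f)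
      zero_smul f := PresheafOfModules.hom_ext fun X => zero_smul K ((eval A X).map f) }
  smul_comp M N P c f g := PresheafOfModules.hom_ext fun X =>
    Linear.smul_comp _ _ _ c ((eval A X).map f) ((eval A X).map g)
  comp_smul M N P f c g := PresheafOfModules.hom_ext fun X =>
    Linear.comp_smul _ _ _ ((eval A X).map f) c ((eval A X).map g)

noncomputable instance ModuleSystem.evalMonoidal (A : Iᵒᵖ ⥤ CommAlgCat.{u} K) (i : Iᵒᵖ) :
    (ModuleSystem.eval A i).Monoidal :=
  Functor.CoreMonoidal.toMonoidal
    { εIso := Iso.refl _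
      μIso _ _ := Iso.refl _
      associativity _ _ _ := ModuleCat.MonoidalCategory.tensor_ext₃' fun _ _ _ ↦ rfl
      left_unitality _ := ModuleCat.MonoidalCategory.tensor_ext fun _ _ ↦ rfl
      right_unitality _ := ModuleCat.MonoidalCategory.tensor_ext fun _ _ ↦ rfl }

/-- The limit `lim_i M_{A_i}` of the categories of modules over a diagram of commutative algebras,
the transition functors being the extensions of scalars: an object is a family of `A_i`-modules
`M_i` with compatible isomorphisms `A_i ⊗_{A_j} M_j ≅ M_i`, encoded by the corresponding
`A_j`-linear maps `M_j ⟶ M_i`; a morphism is a family of `A_i`-linear maps compatible with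
these. It carries the componentwise tensor product, with unit `{A_i}`, and the componentwise
`K`-linear structure. This is the category of quasi-coherent sheaves on the formal colimit of the
affine schemes `Spec A_i`. -/
abbrev LimMod (A : Iᵒᵖ ⥤ CommAlgCat.{u} K) : Type (u + 1) :=
  (isCartesian (A ⋙ forget₂ (CommAlgCat.{u} K) CommRingCat.{u})).FullSubcategory

/-- The symmetric monoidal projection `lim_i M_{A_i} ⥤ M_{A_i}`. -/
abbrev LimMod.proj (A : Iᵒᵖ ⥤ CommAlgCat.{u} K) (i : Iᵒᵖ) :
    LimMod A ⥤ ModuleCat.{u} (A.obj i) :=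
  (isCartesian _).ι ⋙ ModuleSystem.eval A i

/-- The transition map `M_j ⟶ M_i` of an object of `lim_i M_{A_i}`. -/
noncomputable def LimMod.trans {A : Iᵒᵖ ⥤ CommAlgCat.{u} K} (M : LimMod A) {j i : Iᵒᵖ} (t : j ⟶ i)
    (m : (proj A j).obj M) : (proj A i).obj M :=
  M.obj.map t m

end LimitOfModuleCategories

/-! ### Pro-algebras -/

section ProAlgebras

variable {K : Type u} [CommRing K]
variable {I : Type u} [PartialOrder I] [IsDirectedOrder I]
variable {J : Type u} [PartialOrder J] [IsDirectedOrder J]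
variable {L : Type u} [PartialOrder L] [IsDirectedOrder L]

/-- Two morphisms `A_i ⟶ S`, `A_{i'} ⟶ S` are identified in `colim_i hom(A_i, S)` if they agree
on some `A_k` with `k ≥ i, i'`. -/
def colimHomSetoid (A : Iᵒᵖ ⥤ CommAlgCat.{u} K) (S : CommAlgCat.{u} K) :
    Setoid (Σ i : I, A.obj (op i) ⟶ S) where
  r x y := ∃ (k : I) (hx : x.1 ≤ k) (hy : y.1 ≤ k),
    A.map (homOfLE hx).op ≫ x.2 = A.map (homOfLE hy).op ≫ y.2
  iseqv :=
    { refl := fun x => ⟨x.1, le_rfl, le_rfl, rfl⟩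
      symm := fun ⟨k, hx, hy, h⟩ => ⟨k, hy, hx, h.symm⟩
      trans := by
        rintro x y z ⟨k, hx, hy, h⟩ ⟨k', hy', hz, h'⟩
        obtain ⟨m, hm, hm'⟩ := exists_ge_ge k k'
        refine ⟨m, hx.trans hm, hz.trans hm', ?_⟩
        have e : ∀ {a b c : I} (hab : a ≤ b) (hbc : b ≤ c),
            A.map (homOfLE (hab.trans hbc)).op =
              A.map (homOfLE hbc).op ≫ A.map (homOfLE hab).op := by
          intro a b c hab hbc
          rw [← A.map_comp]
          rfl
        rw [e hx hm, e hz hm', Category.assoc, Category.assoc, h, ← h', ← Category.assoc,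
          ← Category.assoc, ← e hy hm, ← e hy' hm'] }

/-- The filtered colimit `colim_i hom(A_i, S)`. -/
def ColimHom (A : Iᵒᵖ ⥤ CommAlgCat.{u} K) (S : CommAlgCat.{u} K) : Type u :=
  Quotient (colimHomSetoid A S)

namespace ColimHom

variable {A : Iᵒᵖ ⥤ CommAlgCat.{u} K} {S S' S'' : CommAlgCat.{u} K}

/-- The class of a morphism `A_i ⟶ S`. -/
def mk (i : I) (g : A.obj (op i) ⟶ S) : ColimHom A S :=
  Quotient.mk (colimHomSetoid A S) ⟨i, g⟩

theorem mk_map {i k : I} (h : i ≤ k) (g : A.obj (op i) ⟶ S) :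
    mk k (A.map (homOfLE h).op ≫ g) = mk i g := by
  refine Quotient.sound ⟨k, le_rfl, h, ?_⟩
  change A.map (𝟙 _) ≫ _ = _
  rw [A.map_id, Category.id_comp]

/-- Composition with a morphism `S ⟶ S'`. -/
def comp (x : ColimHom A S) (s : S ⟶ S') : ColimHom A S' :=
  Quotient.map (sa := colimHomSetoid A S) (sb := colimHomSetoid A S')
    (fun p => ⟨p.1, p.2 ≫ s⟩)
    (by
      rintro x y ⟨k, hx, hy, h⟩
      refine ⟨k, hx, hy, ?_⟩
      dsimp only
      rw [← Category.assoc, ← Category.assoc, h]) x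

@[simp]
theorem mk_comp (i : I) (g : A.obj (op i) ⟶ S) (s : S ⟶ S') : (mk i g).comp s = mk i (g ≫ s) :=
  rfl

theorem comp_id (x : ColimHom A S) : x.comp (𝟙 S) = x := by
  obtain ⟨i, g⟩ := x
  exact congrArg (mk i) (Category.comp_id g)

theorem comp_comp (x : ColimHom A S) (s : S ⟶ S') (s' : S' ⟶ S'') :
    (x.comp s).comp s' = x.comp (s ≫ s') := by
  obtain ⟨i, g⟩ := x
  exact congrArg (mk i) (Category.assoc g s s')

end ColimHom

/-- Morphisms of pro-algebras: `hom(A, B) = lim_j colim_i hom(A_i, B_j)`. -/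
@[ext]
structure ProHom (A : Iᵒᵖ ⥤ CommAlgCat.{u} K) (B : Jᵒᵖ ⥤ CommAlgCat.{u} K) : Type u where
  app (j : J) : ColimHom A (B.obj (op j))
  app_comp {j j' : J} (h : j ≤ j') : (app j').comp (B.map (homOfLE h).op) = app j

namespace ProHom

variable {A : Iᵒᵖ ⥤ CommAlgCat.{u} K} {B : Jᵒᵖ ⥤ CommAlgCat.{u} K} {C : Lᵒᵖ ⥤ CommAlgCat.{u} K}

/-- The composite of a morphism of pro-algebras `A ⟶ B` with an element of
`colim_j hom(B_j, S)`. -/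
def compColim (φ : ProHom A B) {S : CommAlgCat.{u} K} (y : ColimHom B S) : ColimHom A S :=
  Quotient.lift (s := colimHomSetoid B S) (fun p => (φ.app p.1).comp p.2)
    (by
      rintro x y ⟨k, hx, hy, h⟩
      rw [← φ.app_comp hx, ← φ.app_comp hy, ColimHom.comp_comp, ColimHom.comp_comp, h]) y

theorem compColim_comp (φ : ProHom A B) {S S' : CommAlgCat.{u} K} (y : ColimHom B S)
    (s : S ⟶ S') : (φ.compColim y).comp s = φ.compColim (y.comp s) := by
  obtain ⟨j, g⟩ := y
  exact ColimHom.comp_comp (φ.app j) g s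

/-- The identity of a pro-algebra. -/
def id (A : Iᵒᵖ ⥤ CommAlgCat.{u} K) : ProHom A A where
  app i := ColimHom.mk i (𝟙 _)
  app_comp {i k} h := by
    rw [ColimHom.mk_comp, Category.id_comp, ← ColimHom.mk_map h (𝟙 _), Category.comp_id]

/-- The composition of morphisms of pro-algebras. -/
def comp (φ : ProHom A B) (ψ : ProHom B C) : ProHom A C where
  app l := φ.compColim (ψ.app l)
  app_comp h := by rw [compColim_comp, ψ.app_comp h]

end ProHom

end ProAlgebras

/-- An acceptable commutative pro-algebra over `K`: a functor `Iᵒᵖ ⥤ {commutative K-algebras}` for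
some (nonempty) directed poset `I` of countable cofinality, all of whose transition maps
`A_j ⟶ A_i` are surjective. -/
structure AcceptableProAlgebra (K : Type u) [CommRing K] : Type (u + 1) where
  Index : Type u
  [partialOrder : PartialOrder Index]
  [directed : IsDirectedOrder Index]
  [nonempty : Nonempty Index]
  countable_cofinal : ∃ s : Set Index, s.Countable ∧ IsCofinal s
  alg : Indexᵒᵖ ⥤ CommAlgCat.{u} K
  surjective {i j : Index} (h : i ≤ j) : Function.Surjective (alg.map (homOfLE h).op).hom

namespace AcceptableProAlgebra

attribute [instance] partialOrder directed nonempty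

variable {K : Type u} [CommRing K]

/-- The category of acceptable commutative pro-algebras (indexed by varying posets). -/
instance : Category.{u} (AcceptableProAlgebra K) where
  Hom A B := ProHom A.alg B.alg
  id A := ProHom.id A.alg
  comp φ ψ := φ.comp ψ
  id_comp {A B} φ := by
    refine ProHom.ext (funext fun j => ?_)
    change (ProHom.id A.alg).compColim (φ.app j) = φ.app j
    obtain ⟨i, g⟩ := φ.app j
    exact congrArg (ColimHom.mk i) (Category.id_comp g)
  comp_id {A B} φ := ProHom.ext (funext fun j => ColimHom.comp_id (φ.app j))
  assoc {A B C D} φ ψ χ := by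
    refine ProHom.ext (funext fun l => ?_)
    change (φ.comp ψ).compColim (χ.app l) = φ.compColim (ψ.compColim (χ.app l))
    obtain ⟨k, g⟩ := χ.app l
    exact ProHom.compColim_comp φ (ψ.app k) g

end AcceptableProAlgebra

/-! ### Inverse image functors -/

section InverseImages

variable {K : Type u} [CommRing K]
variable {I : Type u} [PartialOrder I] [IsDirectedOrder I]
variable {J : Type u} [PartialOrder J] [IsDirectedOrder J]

/-- The structure of inverse image functor `f^*` along the element `x` of `colim_i hom(A_i, S)`
(that is, along the morphism `f : Spec S ⟶ colim_i Spec A_i` given by `x`) on a monoidal functor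
`G : lim_i M_{A_i} ⥤ M_S`: for every representative `g : A_i ⟶ S` of `x`, a monoidal
natural isomorphism `S ⊗_{A_i} M_i ≅ G M`, these isomorphisms being compatible with changing `i`,
via `M_k ⟶ M_i`. -/
structure InverseImageData (A : Iᵒᵖ ⥤ CommAlgCat.{u} K) {S : CommAlgCat.{u} K}
    (x : ColimHom A S) (G : LimMod A ⥤ ModuleCat.{u} S) [G.LaxMonoidal] where
  iso (i : I) (g : A.obj (op i) ⟶ S) (hg : ColimHom.mk i g = x) :
    LimMod.proj A (op i) ⋙ ModuleCat.extendScalars.{u, u, u} g.hom.toRingHom ≅ G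
  isMonoidal (i : I) (g : A.obj (op i) ⟶ S) (hg : ColimHom.mk i g = x) :
    NatTrans.IsMonoidal (iso i g hg).hom
  compatible {i k : I} (h : i ≤ k) (g : A.obj (op i) ⟶ S) (hg : ColimHom.mk i g = x)
    (M : LimMod A) (m : (LimMod.proj A (op k)).obj M) :
    (iso k (A.map (homOfLE h).op ≫ g) ((ColimHom.mk_map h g).trans hg)).hom.app M
        ((1 : S) ⊗ₜ[A.obj (op k), (A.map (homOfLE h).op ≫ g).hom.toRingHom] m) =
      (iso i g hg).hom.app M
        ((1 : S) ⊗ₜ[A.obj (op i), g.hom.toRingHom] (M.trans (homOfLE h).op m))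

/-- `G` is the inverse image functor along the element `x` of `colim_i hom(A_i, S)`. -/
def IsInverseImage (A : Iᵒᵖ ⥤ CommAlgCat.{u} K) {S : CommAlgCat.{u} K}
    (x : ColimHom A S) (G : LimMod A ⥤ ModuleCat.{u} S) [G.LaxMonoidal] : Prop :=
  Nonempty (InverseImageData A x G)

/-- A monoidal functor `F : lim_i M_{A_i} ⥤ lim_j M_{B_j}` is the inverse image functor along the
morphism of pro-algebras `φ : A ⟶ B` if there are monoidal natural isomorphisms
`(F M)_j ≅ B_j ⊗_{A_i} M_i` for all representatives `g : A_i ⟶ B_j` of the components of `φ`,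
compatible with changing `i` and with changing `j`. -/
def IsProInverseImage {A : Iᵒᵖ ⥤ CommAlgCat.{u} K} {B : Jᵒᵖ ⥤ CommAlgCat.{u} K}
    (φ : ProHom A B) (F : LimMod A ⥤ LimMod B) [F.LaxMonoidal] : Prop :=
  ∃ D : ∀ j : J, InverseImageData A (φ.app j) (F ⋙ LimMod.proj B (op j)),
    ∀ (j j' : J) (h : j ≤ j') (i : I) (g : A.obj (op i) ⟶ B.obj (op j'))
      (hg : ColimHom.mk i g = φ.app j')
      (hg' : ColimHom.mk i (g ≫ B.map (homOfLE h).op) = φ.app j)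
      (M : LimMod A) (m : (LimMod.proj A (op i)).obj M),
      (F.obj M).trans (homOfLE h).op
          (((D j').iso i g hg).hom.app M
            ((1 : B.obj (op j')) ⊗ₜ[A.obj (op i), g.hom.toRingHom] m)) =
        ((D j).iso i (g ≫ B.map (homOfLE h).op) hg').hom.app M
          ((1 : B.obj (op j)) ⊗ₜ[A.obj (op i), (g ≫ B.map (homOfLE h).op).hom.toRingHom] m)

/-- The affine ind-scheme `colim_i Spec A_i` is *tensorial*, or *2-affine*: for every commutative
`K`-algebra `S`, every `x` in `colim_i hom(A_i, S)` has an inverse image functor in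
`Hom_⊗(lim_i M_{A_i}, M_S)`, and the functor from the discrete category `colim_i hom(A_i, S)` to
`Hom_⊗(lim_i M_{A_i}, M_S)` which sends `x` to the inverse image functor along `x` (for any choice
of these) is an equivalence of categories. -/
def IsTensorial (A : Iᵒᵖ ⥤ CommAlgCat.{u} K) : Prop :=
  ∀ S : CommAlgCat.{u} K,
    (∀ x : ColimHom A S, ∃ G : TensorFunctor K (LimMod A) (ModuleCat.{u} S),
      IsInverseImage A x G.functor) ∧
    ∀ Φ : ColimHom A S → TensorFunctor K (LimMod A) (ModuleCat.{u} S),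
      (∀ x, IsInverseImage A x (Φ x).functor) → (Discrete.functor Φ).IsEquivalence

end InverseImages

/-! Write `1` for the unit of the limit category. A section `1 ⟶ M` is a compatible family of
elements of the `M_i`. The transition maps are surjective and there is a cofinal sequence of
indices, so a Mittag-Leffler argument extends every element of every `M_i` to a section
(`exists_ev`). It also extends elements of the componentwise kernels of a componentwise surjective
map (`exists_ev_of_map_eq_zero`). Hence `1` is a strong generator, and it is presentable for a large
enough cardinal, which gives local presentability. Moreover each `M` is the cokernel of a map
between coproducts of copies of `1`, so a cocontinuous functor is controlled by its value at `1` and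
its effect on sections.

Let `G` be a tensor functor to `S`-modules. The ring `End(1) = lim A_i` acts on `G 1 ≅ S`, hence
maps to `S`. The crucial point is that this map factors through a single `A_i`
(`exists_image_eq_zero`): otherwise a null sequence of endomorphisms would sum to a section of an
infinite coproduct of copies of `1` whose image under `G` has infinitely many nonzero coordinates.
It follows that `G` sends every section vanishing at `i` to zero (`image_eq_zero`), so sending the
value at `i` of a section to its image under `G` defines `S ⊗ M_i ⟶ G M`. This is an isomorphism for
`M = 1`, hence for all `M` (`exists_pullback_iso`).

A monoidal transformation is forced on images of sections, and these generate `G M`. So there is at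
most one transformation between two tensor functors, and it exists only if both have the same
scalars `End(1) ⟶ S`. Thus being an inverse image functor along `x` just means acting on `End(1)`
through `x` (`isInverseImage_iff`, `isProInverseImage_iff`), and all compatibilities in `i` and `j`
become automatic. For the target `lim_j M_{B_j}` one argues on each component. -/

namespace LimMod

section

variable {K : Type u} [CommRing K] {I : Type u} [Category.{u} I] {A : Iᵒᵖ ⥤ CommAlgCat.{u} K}

/-! ### Elementwise calculus in the limit category -/

theorem trans_add (M : LimMod A) {X Y : Iᵒᵖ} (t : X ⟶ Y) (m n : (proj A X).obj M) :
    M.trans t (m + n) = M.trans t m + M.trans t n :=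
  map_add (M.obj.map t).hom m n

theorem trans_zero (M : LimMod A) {X Y : Iᵒᵖ} (t : X ⟶ Y) :
    M.trans t (0 : (proj A X).obj M) = 0 :=
  map_zero (M.obj.map t).hom

theorem trans_smul (M : LimMod A) {X Y : Iᵒᵖ} (t : X ⟶ Y) (r : A.obj X) (m : (proj A X).obj M) :
    M.trans t (r • m) = (A.map t).hom r • M.trans t m :=
  PresheafOfModules.map_smul M.obj t r m

theorem trans_id (M : LimMod A) {X : Iᵒᵖ} (m : (proj A X).obj M) : M.trans (𝟙 X) m = m := by
  change M.obj.map (𝟙 X) m = m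
  rw [M.obj.map_id]
  rfl

theorem trans_comp (M : LimMod A) {X Y Z : Iᵒᵖ} (s : X ⟶ Y) (t : Y ⟶ Z) (m : (proj A X).obj M) :
    M.trans (s ≫ t) m = M.trans t (M.trans s m) :=
  PresheafOfModules.map_comp_apply M.obj s t m

theorem map_trans {M N : LimMod A} (f : M ⟶ N) {X Y : Iᵒᵖ} (t : X ⟶ Y) (m : (proj A X).obj M) :
    (proj A Y).map f (M.trans t m) = N.trans t ((proj A X).map f m) :=
  PresheafOfModules.naturality_apply f.hom t m

theorem hom_ext_apply {M N : LimMod A} {f g : M ⟶ N}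
    (h : ∀ X (m : (proj A X).obj M), (proj A X).map f m = (proj A X).map g m) : f = g := by
  apply ObjectProperty.hom_ext
  apply PresheafOfModules.hom_ext
  intro X
  apply ModuleCat.hom_ext
  exact LinearMap.ext (h X)

/-- A morphism of `LimMod A` given by its components. -/
noncomputable def mkHom {M N : LimMod A} (f : ∀ X, (proj A X).obj M ⟶ (proj A X).obj N)
    (h : ∀ ⦃X Y : Iᵒᵖ⦄ (t : X ⟶ Y) (m : (proj A X).obj M),
      f Y (M.trans t m) = N.trans t (f X m)) : M ⟶ N :=
  ObjectProperty.homMk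
    { app := f
      naturality {X Y} t := by
        apply ModuleCat.hom_ext
        exact LinearMap.ext (h t) }

theorem proj_map_comp_apply {M N P : LimMod A} (f : M ⟶ N) (g : N ⟶ P) (X : Iᵒᵖ)
    (m : (proj A X).obj M) :
    (proj A X).map (f ≫ g) m = (proj A X).map g ((proj A X).map f m) := rfl

instance (X : Iᵒᵖ) : (proj A X).Additive where

instance (X : Iᵒᵖ) : (proj A X).Linear K where

theorem isIso_iff {M N : LimMod A} (f : M ⟶ N) : IsIso f ↔ ∀ X, IsIso ((proj A X).map f) := by
  refine ⟨fun _ X => inferInstance, fun h => ?_⟩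
  let g : N ⟶ M := mkHom (fun X => inv ((proj A X).map f)) (fun X Y t m => by
    obtain ⟨m, rfl⟩ := ((ConcreteCategory.isIso_iff_bijective _).1 (h X)).2 m
    apply ((ConcreteCategory.isIso_iff_bijective _).1 (h Y)).1
    rw [← map_trans]
    have e (Z : Iᵒᵖ) (n : (proj A Z).obj M) :
        inv ((proj A Z).map f) ((proj A Z).map f n) = n :=
      congr($(IsIso.hom_inv_id ((proj A Z).map f)) n)
    exact (congrArg _ (e Y _)).trans ((map_trans f t m).trans
      ((congrArg (fun n => N.trans t ((proj A X).map f n)) (e X m)).symm.trans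
        (map_trans f t _).symm)))
  refine ⟨g, hom_ext_apply fun X m => ?_, hom_ext_apply fun X m => ?_⟩
  · exact congr($(IsIso.hom_inv_id ((proj A X).map f)) m)
  · exact congr($(IsIso.inv_hom_id ((proj A X).map f)) m)

/-! ### Sections -/

/-- The value at `X` of a section of `M`, that is of a morphism from the unit object. -/
noncomputable def ev {M : LimMod A} (s : 𝟙_ (LimMod A) ⟶ M) (X : Iᵒᵖ) : (proj A X).obj M :=
  (proj A X).map s (1 : A.obj X)

theorem trans_ev {M : LimMod A} (s : 𝟙_ (LimMod A) ⟶ M) {X Y : Iᵒᵖ} (t : X ⟶ Y) :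
    M.trans t (ev s X) = ev s Y := by
  refine (map_trans s t (show (proj A X).obj (𝟙_ (LimMod A)) from (1 : A.obj X))).symm.trans ?_
  exact congrArg (fun r : A.obj Y => (proj A Y).map s r) (map_one (A.map t).hom)

theorem ev_comp {M N : LimMod A} (s : 𝟙_ (LimMod A) ⟶ M) (f : M ⟶ N) (X : Iᵒᵖ) :
    ev (s ≫ f) X = (proj A X).map f (ev s X) := rfl

theorem proj_map_unit {M : LimMod A} (s : 𝟙_ (LimMod A) ⟶ M) (X : Iᵒᵖ) (r : A.obj X) :
    (proj A X).map s r = r • ev s X := by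
  have := map_smul ((proj A X).map s).hom r (1 : A.obj X)
  refine Eq.trans ?_ this
  exact congrArg (fun r : A.obj X => (proj A X).map s r) (mul_one r).symm

theorem ev_smul {M : LimMod A} (a : 𝟙_ (LimMod A) ⟶ 𝟙_ (LimMod A)) (s : 𝟙_ (LimMod A) ⟶ M)
    (X : Iᵒᵖ) : ev (a ≫ s) X = (show A.obj X from ev a X) • ev s X :=
  proj_map_unit s X _

theorem ev_add {M : LimMod A} (s t : 𝟙_ (LimMod A) ⟶ M) (X : Iᵒᵖ) :
    ev (s + t) X = ev s X + ev t X := rfl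

theorem ev_sub {M : LimMod A} (s t : 𝟙_ (LimMod A) ⟶ M) (X : Iᵒᵖ) :
    ev (s - t) X = ev s X - ev t X := rfl

theorem ev_ext {M : LimMod A} {s t : 𝟙_ (LimMod A) ⟶ M} (h : ∀ X, ev s X = ev t X) : s = t :=
  hom_ext_apply fun X r => by rw [proj_map_unit s X r, proj_map_unit t X r, h X]

/-- With `ev_ext`, this identifies `Hom(1, M)` with the set-theoretic limit of the components of
`M`; in particular `End(1)` is `lim A_i`. -/
theorem exists_ev_eq {M : LimMod A} (m : ∀ X, (proj A X).obj M)
    (h : ∀ ⦃X Y : Iᵒᵖ⦄ (t : X ⟶ Y), M.trans t (m X) = m Y) :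
    ∃ s : 𝟙_ (LimMod A) ⟶ M, ∀ X, ev s X = m X := by
  refine ⟨mkHom (fun X => ModuleCat.ofHom (LinearMap.toSpanSingleton (A.obj X) _ (m X))) ?_, ?_⟩
  · intro X Y t r
    have := M.trans_smul t r (m X)
    rw [h t] at this
    exact this.symm
  · intro X
    exact one_smul (A.obj X) (m X)

/-- The section `s ⊗ t` of `M ⊗ N`. -/
noncomputable def tensorSection {M N : LimMod A} (s : 𝟙_ (LimMod A) ⟶ M)
    (t : 𝟙_ (LimMod A) ⟶ N) : 𝟙_ (LimMod A) ⟶ M ⊗ N :=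
  (λ_ (𝟙_ (LimMod A))).inv ≫ (s ⊗ₘ t)

end

end LimMod

/-! ### Colimits and the tensor product, computed componentwise -/

section

variable {K : Type u} [CommRing K] {I : Type u} [Category.{u} I]

/-- The maps `R Y ⊗_{R X} M X ⟶ M Y` as a natural transformation in `M`. -/
noncomputable def baseChangeNatTrans (R : Iᵒᵖ ⥤ CommRingCat.{u}) {X Y : Iᵒᵖ} (f : X ⟶ Y) :
    (PresheafOfModules.evaluation (R ⋙ forget₂ CommRingCat.{u} RingCat.{u}) X :
      _ ⥤ ModuleCat.{u} (R.obj X)) ⋙ ModuleCat.extendScalars.{u, u, u} (R.map f).hom ⟶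
    (PresheafOfModules.evaluation (R ⋙ forget₂ CommRingCat.{u} RingCat.{u}) Y :
      _ ⥤ ModuleCat.{u} (R.obj Y)) where
  app M := baseChangeMap M f
  naturality M N φ := by
    apply ((ModuleCat.extendRestrictScalarsAdj (R.map f).hom).homEquiv _ _).injective
    apply ModuleCat.hom_ext
    refine LinearMap.ext fun m => ?_
    refine (one_smul (R.obj Y) _).trans (Eq.trans ?_
      (congrArg (φ.app Y).hom (one_smul (R.obj Y) ((M.map f).hom m))).symm)
    exact (PresheafOfModules.naturality_apply φ f m).symm

/-- Evaluation and extension of scalars both preserve colimits, so the base change map of a colimit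
is the colimit of the base change maps. -/
theorem isCartesian_of_isColimit {R : Iᵒᵖ ⥤ CommRingCat.{u}} {J : Type u} [Category.{u} J]
    (F : J ⥤ PresheafOfModules.{u} (R ⋙ forget₂ CommRingCat.{u} RingCat.{u}))
    (hF : ∀ j, isCartesian R (F.obj j)) (c : Cocone F) (hc : IsColimit c) :
    isCartesian R c.pt := by
  intro X Y f
  have : PreservesColimitsOfSize.{u, u}
      (PresheafOfModules.evaluation (R ⋙ forget₂ CommRingCat.{u} RingCat.{u}) X :
        _ ⥤ ModuleCat.{u} (R.obj X)) :=
    PresheafOfModules.evaluation_preservesColimitsOfSize.{u, u} _ X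
  have : PreservesColimitsOfSize.{u, u}
      (PresheafOfModules.evaluation (R ⋙ forget₂ CommRingCat.{u} RingCat.{u}) Y :
        _ ⥤ ModuleCat.{u} (R.obj Y)) :=
    PresheafOfModules.evaluation_preservesColimitsOfSize.{u, u} _ Y
  have : IsIso (Functor.whiskerLeft F (baseChangeNatTrans R f)) :=
    (NatTrans.isIso_iff_isIso_app _).2 fun j => hF j f
  exact isIso_app_coconePt_of_preservesColimit F (baseChangeNatTrans R f) c hc

instance (R : Iᵒᵖ ⥤ CommRingCat.{u}) (J : Type u) [Category.{u} J] :
    (isCartesian R).IsClosedUnderColimitsOfShape J where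
  colimitsOfShape_le := by
    rintro M ⟨p⟩
    exact isCartesian_of_isColimit p.diag p.prop_diag_obj p.cocone p.isColimit

namespace LimMod

instance (A : Iᵒᵖ ⥤ CommAlgCat.{u} K) : HasColimitsOfSize.{u, u} (LimMod A) where
  has_colimits_of_shape J _ :=
    hasColimitsOfShape_of_closedUnderColimits J (isCartesian _)

instance (A : Iᵒᵖ ⥤ CommAlgCat.{u} K) (X : Iᵒᵖ) :
    PreservesColimitsOfSize.{u, u} (ModuleSystem.eval A X) :=
  PresheafOfModules.evaluation_preservesColimitsOfSize.{u, u} _ X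

instance (A : Iᵒᵖ ⥤ CommAlgCat.{u} K) :
    PreservesColimitsOfSize.{u, u}
      (isCartesian (A ⋙ forget₂ (CommAlgCat.{u} K) CommRingCat.{u})).ι where
  preservesColimitsOfShape {J} _ :=
    { preservesColimit {F} := by
        have := createsColimitFullSubcategoryInclusionOfClosed J
          (isCartesian (A ⋙ forget₂ (CommAlgCat.{u} K) CommRingCat.{u})) F
        infer_instance }

instance (A : Iᵒᵖ ⥤ CommAlgCat.{u} K) (X : Iᵒᵖ) :
    PreservesColimitsOfSize.{u, u} (proj A X) :=
  inferInstanceAs (PreservesColimitsOfSize.{u, u} (_ ⋙ _))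

/-- A cocone in `LimMod A` is a colimit cocone if all its components are. -/
noncomputable def isColimitOfProj {A : Iᵒᵖ ⥤ CommAlgCat.{u} K} {J : Type u} [Category.{u} J]
    {F : J ⥤ LimMod A} (c : Cocone F) (hc : ∀ X, IsColimit ((proj A X).mapCocone c)) :
    IsColimit c :=
  isColimitOfReflects (isCartesian _).ι
    (PresheafOfModules.evaluationJointlyReflectsColimits _ _ fun X => hc X)

theorem preservesColimitsOfSize_of_proj {A : Iᵒᵖ ⥤ CommAlgCat.{u} K} {C : Type*} [Category* C]
    (F : C ⥤ LimMod A) (h : ∀ X, PreservesColimitsOfSize.{u, u} (F ⋙ proj A X)) :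
    PreservesColimitsOfSize.{u, u} F where
  preservesColimitsOfShape :=
    { preservesColimit :=
        { preserves hc := ⟨isColimitOfProj _ fun X => isColimitOfPreserves (F ⋙ proj A X) hc⟩ } }

instance (A : Iᵒᵖ ⥤ CommAlgCat.{u} K) (M : LimMod A) :
    PreservesColimitsOfSize.{u, u} (tensorLeft M) :=
  preservesColimitsOfSize_of_proj _ fun X =>
    inferInstanceAs (PreservesColimitsOfSize.{u, u}
      (proj A X ⋙ tensorLeft (C := ModuleCat.{u} (A.obj X)) ((proj A X).obj M)))

instance (A : Iᵒᵖ ⥤ CommAlgCat.{u} K) (M : LimMod A) :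
    PreservesColimitsOfSize.{u, u} (tensorRight M) :=
  preservesColimits_of_natIso (BraidedCategory.tensorLeftIsoTensorRight M)

instance (A : Iᵒᵖ ⥤ CommAlgCat.{u} K) : MonoidalPreadditive (LimMod A) where
  whiskerLeft_zero {M _ _} := hom_ext_apply fun X m =>
    congr($(MonoidalPreadditive.whiskerLeft_zero (C := ModuleCat.{u} (A.obj X))
      (X := (proj A X).obj M)) m)
  zero_whiskerRight {M _ _} := hom_ext_apply fun X m =>
    congr($(MonoidalPreadditive.zero_whiskerRight (C := ModuleCat.{u} (A.obj X))
      (X := (proj A X).obj M)) m)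
  whiskerLeft_add {M _ _} f g := hom_ext_apply fun X m =>
    congr($(MonoidalPreadditive.whiskerLeft_add (C := ModuleCat.{u} (A.obj X))
      (X := (proj A X).obj M) ((proj A X).map f) ((proj A X).map g)) m)
  add_whiskerRight {M _ _} f g := hom_ext_apply fun X m =>
    congr($(MonoidalPreadditive.add_whiskerRight (C := ModuleCat.{u} (A.obj X))
      (X := (proj A X).obj M) ((proj A X).map f) ((proj A X).map g)) m)

instance (A : Iᵒᵖ ⥤ CommAlgCat.{u} K) : MonoidalLinear K (LimMod A) where
  whiskerLeft_smul M {_ _} r f := hom_ext_apply fun X m =>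
    congr($(MonoidalLinear.whiskerLeft_smul (R := A.obj X) (C := ModuleCat.{u} (A.obj X))
      ((proj A X).obj M) (algebraMap K (A.obj X) r) ((proj A X).map f)) m)
  smul_whiskerRight r {_ _} f P := hom_ext_apply fun X m =>
    congr($(MonoidalLinear.smul_whiskerRight (R := A.obj X) (C := ModuleCat.{u} (A.obj X))
      (algebraMap K (A.obj X) r) ((proj A X).map f) ((proj A X).obj P)) m)

end LimMod

end

/-! ### Lifting elements to sections (Mittag-Leffler) -/

/-- Since `S ≅ R ⧸ ker`, the map `m ↦ 1 ⊗ m` is the quotient map `M ⟶ M ⧸ ker • M`. -/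
theorem mem_ker_smul_top_of_one_tmul_eq_zero {R S M : Type*} [CommRing R] [CommRing S] [Algebra R S]
    [AddCommGroup M] [Module R M] (hS : Function.Surjective (algebraMap R S)) {m : M}
    (hm : (1 : S) ⊗ₜ[R] m = 0) : m ∈ RingHom.ker (algebraMap R S) • (⊤ : Submodule R M) := by
  let e : (R ⧸ RingHom.ker (Algebra.ofId R S)) ≃ₐ[R] S :=
    Ideal.quotientKerAlgEquivOfSurjective (f := Algebra.ofId R S) hS
  have h := congrArg (LinearMap.rTensor M e.symm.toLinearMap) hm
  rw [map_zero, LinearMap.rTensor_tmul] at h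
  change e.symm 1 ⊗ₜ[R] m = 0 at h
  rw [map_one] at h
  have h' : m ∈ LinearMap.ker (TensorProduct.mk R (R ⧸ RingHom.ker (Algebra.ofId R S)) M 1) := h
  rwa [LinearMap.ker_tensorProductMk] at h'

section Directed

variable {I : Type*} [PartialOrder I] [IsDirectedOrder I]

/-- Take successive upper bounds along an enumeration of the cofinal set. Starting above `i` lets
the recursion in `exists_compatible_family` begin with a lift of the element prescribed at `i`. -/
theorem exists_monotone_cofinal_seq (hI : ∃ s : Set I, s.Countable ∧ IsCofinal s) (i : I) :
    ∃ σ : ℕ → I, Monotone σ ∧ i ≤ σ 0 ∧ ∀ j, ∃ n, j ≤ σ n := by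
  obtain ⟨s, hs, hs'⟩ := hI
  obtain ⟨j, hj, -⟩ := hs' i
  obtain ⟨e, rfl⟩ := hs.exists_eq_range ⟨j, hj⟩
  choose ub hub hub' using fun a b : I => exists_ge_ge a b
  let σ : ℕ → I := fun n => Nat.rec (ub i (e 0)) (fun n x => ub x (e (n + 1))) n
  refine ⟨σ, monotone_nat_of_le_succ fun n => hub _ _, hub _ _, fun j => ?_⟩
  obtain ⟨_, ⟨n, rfl⟩, hn⟩ := hs' j
  refine ⟨n, hn.trans ?_⟩
  cases n with
  | zero => exact hub' _ _
  | succ n => exact hub' _ _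

/-- In an inverse system with surjective transition maps, indexed by a directed poset of countable
cofinality, each element extends to a compatible family. -/
theorem exists_compatible_family (hI : ∃ s : Set I, s.Countable ∧ IsCofinal s) (F : I → Type*)
    (tr : ∀ {i j : I}, i ≤ j → F j → F i)
    (tr_id : ∀ {i : I} (x : F i), tr le_rfl x = x)
    (tr_comp : ∀ {i j k : I} (h : i ≤ j) (h' : j ≤ k) (x : F k),
      tr h (tr h' x) = tr (h.trans h') x)
    (surj : ∀ {i j : I} (h : i ≤ j), Function.Surjective (tr h)) (i : I) (x : F i) :
    ∃ s : ∀ j, F j, (∀ {j k : I} (h : j ≤ k), tr h (s k) = s j) ∧ s i = x := by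
  obtain ⟨σ, hσ, hi, hc⟩ := exists_monotone_cofinal_seq hI i
  obtain ⟨x₀, rfl⟩ := surj hi x
  choose lift hlift using fun n => surj (hσ (Nat.le_succ n))
  let y : ∀ n, F (σ n) := fun n => Nat.rec x₀ (fun n z => lift n z) n
  have hy (n) : tr (hσ (Nat.le_succ n)) (y (n + 1)) = y n := hlift n (y n)
  have hy' (m n) (h : m ≤ n) : tr (hσ h) (y n) = y m := by
    induction n, h using Nat.le_induction with
    | base => exact tr_id _
    | succ n h ih => rw [← ih, ← hy n, tr_comp]
  have key (j : I) (m n) (hm : j ≤ σ m) (hn : j ≤ σ n) : tr hm (y m) = tr hn (y n) := by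
    rcases le_total m n with h | h
    · rw [← hy' m n h, tr_comp]
    · rw [← hy' n m h, tr_comp]
  choose N hN using hc
  refine ⟨fun j => tr (hN j) (y (N j)), fun {j k} h => ?_, key i _ 0 _ _⟩
  rw [tr_comp]
  exact key j _ _ _ _

end Directed

namespace LimMod

variable {K : Type u} [CommRing K]

section

variable {I : Type u} [Category.{u} I] {A : Iᵒᵖ ⥤ CommAlgCat.{u} K}

theorem trans_surjective (M : LimMod A) {X Y : Iᵒᵖ} (t : X ⟶ Y)
    (ht : Function.Surjective (A.map t).hom) : Function.Surjective (M.trans t) := by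
  intro y
  have := M.property t
  obtain ⟨z, rfl⟩ := ((ConcreteCategory.isIso_iff_bijective (baseChangeMap M.obj t)).1 this).2 y
  induction z using TensorProduct.induction_on with
  | zero => exact ⟨0, (M.trans_zero t).trans (map_zero (baseChangeMap M.obj t).hom).symm⟩
  | tmul r m =>
    obtain ⟨r, rfl⟩ := ht r
    exact ⟨r • m, M.trans_smul t r m⟩
  | add x y hx hy =>
    obtain ⟨x', hx⟩ := hx
    obtain ⟨y', hy⟩ := hy
    refine ⟨x' + y', ?_⟩
    rw [trans_add, hx, hy]
    exact (map_add (baseChangeMap M.obj t).hom x y).symm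

theorem mem_ker_smul_of_trans_eq_zero (M : LimMod A) {X Y : Iᵒᵖ} (t : X ⟶ Y)
    (ht : Function.Surjective (A.map t).hom) (m : (proj A X).obj M) (hm : M.trans t m = 0) :
    m ∈ RingHom.ker (A.map t).hom.toRingHom •
      (⊤ : Submodule (A.obj X) ((proj A X).obj M)) := by
  let := (A.map t).hom.toRingHom.toAlgebra
  have := M.property t
  refine mem_ker_smul_top_of_one_tmul_eq_zero (R := A.obj X) (S := A.obj Y) ht ?_
  apply ((ConcreteCategory.isIso_iff_bijective (baseChangeMap M.obj t)).1 this).1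
  refine Eq.trans ?_ (map_zero (baseChangeMap M.obj t).hom).symm
  exact (one_smul (A.obj Y) (M.trans t m)).trans hm

end

variable {A : AcceptableProAlgebra K}

theorem alg_map_surjective {X Y : A.Indexᵒᵖ} (t : X ⟶ Y) : Function.Surjective (A.alg.map t).hom :=
  A.surjective t.unop.le

/-- The sets cut out by `P` form an inverse system whose transition maps are still surjective.
Allowing a general `P` covers both whole modules and kernels of morphisms. -/
theorem exists_section_of_surjective (M : LimMod A.alg) (P : ∀ X, (proj A.alg X).obj M → Prop)
    (hP : ∀ {X Y : A.Indexᵒᵖ} (t : X ⟶ Y) (m), P X m → P Y (M.trans t m))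
    (hP' : ∀ {X Y : A.Indexᵒᵖ} (t : X ⟶ Y) (m), P Y m → ∃ m', P X m' ∧ M.trans t m' = m)
    (X : A.Indexᵒᵖ) (m : (proj A.alg X).obj M) (hm : P X m) :
    ∃ s : 𝟙_ (LimMod A.alg) ⟶ M, (∀ Y, P Y (ev s Y)) ∧ ev s X = m := by
  obtain ⟨s, hs, hs'⟩ := exists_compatible_family A.countable_cofinal
    (fun i => { m : (proj A.alg (op i)).obj M // P (op i) m })
    (fun {i j} h m => ⟨M.trans (homOfLE h).op m.1, hP _ _ m.2⟩)
    (fun m => Subtype.ext (M.trans_id m.1))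
    (fun h h' m => Subtype.ext (M.trans_comp _ _ m.1).symm)
    (fun h m => by
      obtain ⟨m', h₁, h₂⟩ := hP' (homOfLE h).op m.1 m.2
      exact ⟨⟨m', h₁⟩, Subtype.ext h₂⟩) X.unop ⟨m, hm⟩
  obtain ⟨t, ht⟩ := exists_ev_eq (fun Y => (s Y.unop).1)
    (fun Y Z t => congrArg Subtype.val (hs t.unop.le))
  exact ⟨t, fun Y => (ht Y).symm ▸ (s Y.unop).2, (ht X).trans (congrArg Subtype.val hs')⟩

theorem exists_ev (M : LimMod A.alg) (X : A.Indexᵒᵖ) (m : (proj A.alg X).obj M) :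
    ∃ s : 𝟙_ (LimMod A.alg) ⟶ M, ev s X = m := by
  obtain ⟨s, -, hs⟩ := exists_section_of_surjective M (fun _ _ => True) (fun _ _ _ => trivial)
    (fun t m _ => by
      obtain ⟨m', h⟩ := M.trans_surjective t (alg_map_surjective t) m
      exact ⟨m', trivial, h⟩) X m trivial
  exact ⟨s, hs⟩

/-- If `f : M ⟶ N` has surjective components, then elements of the kernels of the components of `f`
extend to sections of `M` which are killed by `f`. -/
theorem exists_ev_of_map_eq_zero {M N : LimMod A.alg} (f : M ⟶ N)
    (hf : ∀ X, Function.Surjective ((proj A.alg X).map f)) (X : A.Indexᵒᵖ)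
    (m : (proj A.alg X).obj M) (hm : (proj A.alg X).map f m = 0) :
    ∃ s : 𝟙_ (LimMod A.alg) ⟶ M, s ≫ f = 0 ∧ ev s X = m := by
  obtain ⟨s, hs, hs'⟩ := exists_section_of_surjective M
    (fun X m => (proj A.alg X).map f m = 0)
    (fun t m h => by rw [map_trans, h, trans_zero])
    (fun {X Y} t m h => by
      obtain ⟨m', rfl⟩ := M.trans_surjective t (alg_map_surjective t) m
      rw [map_trans] at h
      have h' := N.mem_ker_smul_of_trans_eq_zero t (alg_map_surjective t) _ h
      -- An arbitrary lift `m'` need not be killed by `f`, but `f m'` lies in `ker • N_X`. As `f` is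
      -- onto at `X`, it is also the image of some `z` in `ker • M_X`, and `m' - z` is then a lift
      -- killed by `f`.
      obtain ⟨z, hz, hz'⟩ : ∃ z : (proj A.alg X).obj M, M.trans t z = 0 ∧
          (proj A.alg X).map f z = (proj A.alg X).map f m' := by
        refine Submodule.smul_induction_on h' (fun r hr n _ => ?_) (fun x y hx hy => ?_)
        · obtain ⟨n, rfl⟩ := hf X n
          refine ⟨r • n, ?_, map_smul ((proj A.alg X).map f).hom r n⟩
          rw [trans_smul]
          exact (congrArg (· • M.trans t n) hr).trans (zero_smul (A.alg.obj Y) _)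
        · obtain ⟨a, ha, ha'⟩ := hx
          obtain ⟨b, hb, hb'⟩ := hy
          refine ⟨a + b, ?_, ?_⟩
          · rw [trans_add, ha, hb, add_zero]
          · rw [← ha', ← hb']
            exact map_add ((proj A.alg X).map f).hom a b
      refine ⟨m' - z, ?_, ?_⟩
      · refine (map_sub ((proj A.alg X).map f).hom m' z).trans ?_
        exact sub_eq_zero.2 hz'.symm
      · have := M.trans_add t (m' - z) z
        rw [sub_add_cancel, hz, add_zero] at this
        exact this.symm) X m hm
  exact ⟨s, ev_ext hs, hs'⟩

end LimMod

/-! ### Descent along surjections and local presentability -/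

theorem ModuleCat.exists_desc {R : Type*} [CommRing R] {P M N : ModuleCat.{u} R} (p : P ⟶ M)
    (hp : Function.Surjective p) (f : P ⟶ N) (h : ∀ x, p x = 0 → f x = 0) :
    ∃ g : M ⟶ N, p ≫ g = f := by
  let e := p.hom.quotKerEquivOfSurjective hp
  have hpf : LinearMap.ker p.hom ≤ LinearMap.ker f.hom := fun x hx => h x hx
  refine ⟨ModuleCat.ofHom ((Submodule.liftQ _ f.hom hpf).comp e.symm.toLinearMap),
    ModuleCat.hom_ext (LinearMap.ext fun x => ?_)⟩
  have : e.symm (p.hom x) = Submodule.Quotient.mk x := by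
    rw [LinearEquiv.symm_apply_eq]
    rfl
  change Submodule.liftQ _ f.hom hpf (e.symm (p.hom x)) = f.hom x
  rw [this]
  rfl

namespace LimMod

variable {K : Type u} [CommRing K]

section

variable {I : Type u} [Category.{u} I] (A : Iᵒᵖ ⥤ CommAlgCat.{u} K)

/-- The functors sending an object of `LimMod A` to the underlying sets of its components. -/
noncomputable def projForget : Iᵒᵖ ⥤ LimMod A ⥤ Type u where
  obj X := proj A X ⋙ forget _
  map t :=
    { app M := TypeCat.ofHom (M.trans t)
      naturality M N f := by
        ext m
        exact (map_trans f t m).symm }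
  map_id X := by
    ext M m
    exact M.trans_id m
  map_comp s t := by
    ext M m
    exact M.trans_comp s t m

/-- The functor of sections is the limit of the functors of components. -/
noncomputable def sectionsCone : Cone (projForget A) where
  pt := coyoneda.obj (op (𝟙_ (LimMod A)))
  π :=
    { app X :=
        { app M := TypeCat.ofHom fun s : 𝟙_ (LimMod A) ⟶ M => ev s X
          naturality M N f := rfl }
      naturality X Y t := by
        ext M s
        exact (trans_ev (M := M) s t).symm }

theorem nonempty_isLimit_sectionsCone : Nonempty (IsLimit (sectionsCone A)) := by
  refine ⟨evaluationJointlyReflectsLimits _ fun M => Classical.choice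
    ((Types.isLimit_iff _).2 fun m hm => ?_)⟩
  obtain ⟨s, hs⟩ := exists_ev_eq (M := M) m (fun X Y t => hm t)
  exact ⟨s, hs, fun t ht => ev_ext fun X => (ht X).trans (hs X).symm⟩

/-- `Hom(1, -)` is the limit of the functors `M ↦ M_X`, which preserve filtered colimits; a limit of
fewer than `κ` accessible functors preserves `κ`-filtered colimits. -/
theorem isCardinalPresentable_unit (κ : Cardinal.{u}) [Fact κ.IsRegular]
    (hκ : HasCardinalLT (Arrow Iᵒᵖ) κ) : IsCardinalPresentable (𝟙_ (LimMod A)) κ := by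
  have (X : Iᵒᵖ) : ((projForget A).obj X).IsCardinalAccessible κ :=
    { preservesColimitOfShape J _ _ := by
        have := isFiltered_of_isCardinalFiltered J κ
        exact inferInstanceAs (PreservesColimitsOfShape J (proj A X ⋙ forget _)) }
  exact Functor.isCardinalAccessible_of_isLimit (sectionsCone A)
    (nonempty_isLimit_sectionsCone A).some κ hκ

end

variable {A : AcceptableProAlgebra K}

/-- A morphism with surjective components is the cokernel of the family of the sections of its
source that it kills. -/
theorem exists_desc {P M N : LimMod A.alg} (p : P ⟶ M)
    (hp : ∀ X, Function.Surjective ((proj A.alg X).map p)) (f : P ⟶ N)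
    (h : ∀ r : 𝟙_ (LimMod A.alg) ⟶ P, r ≫ p = 0 → r ≫ f = 0) : ∃ g : M ⟶ N, p ≫ g = f := by
  have h' (X) (x : (proj A.alg X).obj P) (hx : (proj A.alg X).map p x = 0) :
      (proj A.alg X).map f x = 0 := by
    obtain ⟨r, hr, rfl⟩ := exists_ev_of_map_eq_zero p hp X x hx
    rw [← ev_comp, h r hr]
    rfl
  choose g hg using fun X => ModuleCat.exists_desc ((proj A.alg X).map p) (hp X)
    ((proj A.alg X).map f) (h' X)
  have hg' (X) (x : (proj A.alg X).obj P) :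
      g X ((proj A.alg X).map p x) = (proj A.alg X).map f x := congr($(hg X) x)
  refine ⟨mkHom g fun X Y t m => ?_, hom_ext_apply hg'⟩
  obtain ⟨x, rfl⟩ := hp X m
  rw [hg', ← map_trans, hg', map_trans]

theorem epi_of_surjective {P M : LimMod A.alg} (p : P ⟶ M)
    (hp : ∀ X, Function.Surjective ((proj A.alg X).map p)) : Epi p where
  left_cancellation f g h := hom_ext_apply fun X m => by
    obtain ⟨x, rfl⟩ := hp X m
    exact congr((proj A.alg X).map $h x)

/-- Sections reach every element of every component, hence separate morphisms. A monomorphism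
through which all sections lift is componentwise surjective, and `exists_desc` applied to the
identity inverts it, because it kills no nonzero section. -/
theorem isStrongGenerator_unit :
    (ObjectProperty.singleton (𝟙_ (LimMod A.alg))).IsStrongGenerator := by
  rw [ObjectProperty.isStrongGenerator_iff]
  constructor
  · intro M N f g h
    refine hom_ext_apply fun X m => ?_
    obtain ⟨s, rfl⟩ := exists_ev M X m
    rw [← ev_comp, ← ev_comp, h _ (by simp) s]
  · intro M N i _ hi
    have hi' (X) : Function.Surjective ((proj A.alg X).map i) := fun n => by
      obtain ⟨s, rfl⟩ := exists_ev N X n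
      obtain ⟨t, rfl⟩ := hi _ (by simp) s
      exact ⟨ev t X, rfl⟩
    obtain ⟨g, hg⟩ := exists_desc i hi' (𝟙 M) (fun r hr => by
      rw [(cancel_mono i).1 (hr.trans zero_comp.symm), zero_comp])
    have := epi_of_surjective i hi'
    exact ⟨g, hg, by rw [← cancel_epi i, reassoc_of% hg, Category.comp_id]⟩

instance : IsLocallyPresentable.{u} (LimMod A.alg) where
  exists_cardinal := by
    obtain ⟨κ, hκ, hI⟩ := HasCardinalLT.exists_regular_cardinal.{u} (Arrow A.Indexᵒᵖ)
    have : Fact κ.IsRegular := ⟨hκ⟩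
    refine ⟨κ, this, (IsCardinalLocallyPresentable.iff_exists_isStrongGenerator _ _).2
      ⟨_, inferInstance, isStrongGenerator_unit, ?_⟩⟩
    rw [ObjectProperty.singleton_le_iff]
    exact isCardinalPresentable_unit A.alg κ hI

variable (A) in
theorem isTensorLocallyPresentable : IsTensorLocallyPresentable K (LimMod A.alg) where
  locallyPresentable := inferInstance
  monoidalPreadditive := inferInstance
  monoidalLinear := inferInstance
  cocontinuous_left _ := inferInstance
  cocontinuous_right _ := inferInstance

/-! ### Presentations by copies of the unit -/

/-- The canonical morphism from a coproduct of copies of the unit, indexed by a family of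
sections. -/
noncomputable def ofSections {M : LimMod A.alg} {T : Type u} (s : T → (𝟙_ (LimMod A.alg) ⟶ M)) :
    (∐ fun _ : T => 𝟙_ (LimMod A.alg)) ⟶ M :=
  Sigma.desc s

theorem ofSections_surjective (M : LimMod A.alg) (X : A.Indexᵒᵖ) :
    Function.Surjective
      ((proj A.alg X).map (ofSections fun s : (𝟙_ (LimMod A.alg) ⟶ M) => s)) := fun m => by
  obtain ⟨s, rfl⟩ := exists_ev M X m
  refine ⟨ev (Sigma.ι (fun _ : (𝟙_ (LimMod A.alg) ⟶ M) => 𝟙_ (LimMod A.alg)) s) X, ?_⟩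
  rw [← ev_comp, ofSections, Sigma.ι_desc]

/-- A natural transformation between cocontinuous functors on `LimMod A.alg` is an isomorphism if it
is so at the unit. -/
theorem isIso_app_of_isIso_app_unit {D : Type*} [Category* D] {F G : LimMod A.alg ⥤ D}
    [PreservesColimitsOfSize.{u, u} F] [PreservesColimitsOfSize.{u, u} G] (η : F ⟶ G)
    [hη : IsIso (η.app (𝟙_ (LimMod A.alg)))] (M : LimMod A.alg) : IsIso (η.app M) := by
  have key (T : Type u) : IsIso (η.app (∐ fun _ : T => 𝟙_ (LimMod A.alg))) := by
    have : IsIso (Functor.whiskerLeft (Discrete.functor fun _ : T => 𝟙_ (LimMod A.alg)) η) :=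
      (NatTrans.isIso_iff_isIso_app _).2 fun j => hη
    exact isIso_app_coconePt_of_preservesColimit _ η _
      (colimit.isColimit (Discrete.functor fun _ : T => 𝟙_ (LimMod A.alg)))
  let p := ofSections fun s : (𝟙_ (LimMod A.alg) ⟶ M) => s
  -- By `exists_desc`, killing the sections in the kernel of `p` suffices to factor through `p`, so
  -- `M` is the cokernel of `q`.
  let q := ofSections fun r : { r : 𝟙_ (LimMod A.alg) ⟶ _ // r ≫ p = 0 } => r.1
  have hq : q ≫ p = 0 := Sigma.hom_ext _ _ fun r => by
    rw [← Category.assoc, comp_zero]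
    exact (congrArg (· ≫ p) (Sigma.ι_desc _ r)).trans r.2
  have := epi_of_surjective p (ofSections_surjective M)
  have hp {N : LimMod A.alg} (f : _ ⟶ N) (hf : q ≫ f = 0) : ∃ g : M ⟶ N, p ≫ g = f := by
    refine exists_desc p (ofSections_surjective M) f fun r hr => ?_
    have h : Sigma.ι (fun _ : { r : 𝟙_ (LimMod A.alg) ⟶ _ // r ≫ p = 0 } => 𝟙_ (LimMod A.alg))
      ⟨r, hr⟩ ≫ q = r := Sigma.ι_desc _ _
    rw [← h, Category.assoc, hf, comp_zero]
  have hc : IsColimit (CokernelCofork.ofπ p hq) :=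
    CokernelCofork.IsColimit.ofπ p hq (fun f hf => (hp f hf).choose)
      (fun f hf => (hp f hf).choose_spec)
      (fun f hf m hm => by rw [← cancel_epi p, hm, (hp f hf).choose_spec])
  have : IsIso (Functor.whiskerLeft (parallelPair q 0) η) :=
    (NatTrans.isIso_iff_isIso_app _).2 fun j => by cases j <;> exact key _
  have : PreservesFiniteColimits F := PreservesColimitsOfSize.preservesFiniteColimits.{u, u} F
  have : PreservesFiniteColimits G := PreservesColimitsOfSize.preservesFiniteColimits.{u, u} G
  exact isIso_app_coconePt_of_preservesColimit _ η _ hc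

end LimMod

/-- Every element of a coproduct of modules is a finite sum of elements of the summands. -/
theorem ModuleCat.cofan_induction {R : Type*} [CommRing R] {T : Type u} {M : T → ModuleCat.{u} R}
    (c : Cofan M) (hc : IsColimit c) (P : c.pt → Prop) (h0 : P 0)
    (hadd : ∀ x y, P x → P y → P (x + y)) (hι : ∀ t (x : M t), P (c.inj t x)) (x : c.pt) : P x := by
  let N : Submodule R c.pt := ⨆ t, LinearMap.range (c.inj t).hom
  have hN : ModuleCat.ofHom N.mkQ = 0 := by
    refine Cofan.IsColimit.hom_ext hc _ _ fun t => ModuleCat.hom_ext (LinearMap.ext fun x => ?_)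
    refine (Submodule.Quotient.mk_eq_zero N).2 ?_
    exact Submodule.mem_iSup_of_mem t ⟨x, rfl⟩
  have hx : x ∈ N := (Submodule.Quotient.mk_eq_zero N).1 congr($hN x)
  induction hx using Submodule.iSup_induction' with
  | mem t x hx =>
    obtain ⟨x, rfl⟩ := hx
    exact hι t x
  | zero => exact h0
  | add x y _ _ hx hy => exact hadd x y hx hy

/-! ### Images of sections under a lax monoidal functor, and discreteness of the action on the unit
-/

namespace LimMod

open Functor.LaxMonoidal

variable {K : Type u} [CommRing K]

section

variable {I : Type u} [Category.{u} I] {A : Iᵒᵖ ⥤ CommAlgCat.{u} K} {S : CommAlgCat.{u} K}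

/-- The image of a section `s` of `M` under a lax monoidal functor `G`, as an element of `G M`. -/
noncomputable def image (G : LimMod A ⥤ ModuleCat.{u} S) [G.LaxMonoidal] {M : LimMod A}
    (s : 𝟙_ (LimMod A) ⟶ M) : G.obj M :=
  G.map s (ε G (1 : S))

variable (G : LimMod A ⥤ ModuleCat.{u} S) [G.LaxMonoidal]

theorem map_image {M N : LimMod A} (s : 𝟙_ (LimMod A) ⟶ M) (f : M ⟶ N) :
    G.map f (image G s) = image G (s ≫ f) :=
  congr($((G.map_comp s f).symm) (ε G (1 : S)))

theorem image_id : image G (𝟙 _) = ε G (1 : S) :=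
  congr($(G.map_id _) (ε G (1 : S)))

theorem image_add [G.Additive] {M : LimMod A} (s t : 𝟙_ (LimMod A) ⟶ M) :
    image G (s + t) = image G s + image G t :=
  congr($(G.map_add (f := s) (g := t)) (ε G (1 : S)))

theorem image_zero [G.Additive] {M : LimMod A} : image G (0 : 𝟙_ (LimMod A) ⟶ M) = 0 :=
  congr($(G.map_zero _ _) (ε G (1 : S)))

theorem image_sub [G.Additive] {M : LimMod A} (s t : 𝟙_ (LimMod A) ⟶ M) :
    image G (s - t) = image G s - image G t :=
  congr($(G.map_sub (f := s) (g := t)) (ε G (1 : S)))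

theorem image_smul [G.Additive] [G.Linear K] {M : LimMod A} (c : K) (s : 𝟙_ (LimMod A) ⟶ M) :
    image G (c • s) = algebraMap K S c • image G s :=
  congr($(Functor.map_smul (F := G) (r := c) (f := s)) (ε G (1 : S)))

/-- Left unitality gives the case of the unit sections, and naturality of `μ` the rest. This is what
allows monoidality and braidings to be tested on sections. -/
theorem image_tensorSection {M N : LimMod A} (s : 𝟙_ (LimMod A) ⟶ M) (t : 𝟙_ (LimMod A) ⟶ N) :
    image G (tensorSection s t) = μ G M N (image G s ⊗ₜ[S] image G t) := by
  have h : ε G ≫ G.map (λ_ (𝟙_ (LimMod A))).inv =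
      (λ_ (𝟙_ (ModuleCat.{u} S))).inv ≫ (ε G ⊗ₘ ε G) ≫ μ G _ _ := by
    rw [← left_unitality_inv, leftUnitor_inv_naturality_assoc, tensorHom_def'_assoc]
  have h₁ : G.map (λ_ (𝟙_ (LimMod A))).inv (ε G (1 : S)) =
      μ G _ _ (ε G (1 : S) ⊗ₜ[S] ε G (1 : S)) := congr($h (1 : S))
  refine congr($(G.map_comp (λ_ (𝟙_ (LimMod A))).inv (s ⊗ₘ t)) (ε G (1 : S))).trans ?_
  refine (congrArg (G.map (s ⊗ₘ t)) h₁).trans ?_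
  exact congr($((μ_natural G s t).symm) (ε G (1 : S) ⊗ₜ[S] ε G (1 : S)))

/-- `G` acts on the endomorphism `a` of the unit by the scalar `c`. -/
def HasScalar (a : 𝟙_ (LimMod A) ⟶ 𝟙_ (LimMod A)) (c : S) : Prop :=
  image G a = c • (ε G (1 : S))

theorem ε_apply (c : S) : ε G c = c • (ε G (1 : S)) := by
  refine Eq.trans ?_ (map_smul (ε G).hom c (1 : S))
  exact congrArg (fun c : S => ε G c) (mul_one c).symm

variable [hε : IsIso (ε G)]

theorem exists_hasScalar (a : 𝟙_ (LimMod A) ⟶ 𝟙_ (LimMod A)) : ∃ c : S, HasScalar G a c := by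
  obtain ⟨c, hc⟩ := ((ConcreteCategory.isIso_iff_bijective _).1 hε).2 (image G a)
  exact ⟨c, hc.symm.trans (ε_apply G c)⟩

theorem smul_one_injective {c d : S} (h : c • ε G (1 : S) = d • ε G (1 : S)) : c = d := by
  rw [← ε_apply, ← ε_apply] at h
  exact ((ConcreteCategory.isIso_iff_bijective _).1 hε).1 h

theorem HasScalar.unique {a : 𝟙_ (LimMod A) ⟶ 𝟙_ (LimMod A)} {c d : S} (h : HasScalar G a c)
    (h' : HasScalar G a d) : c = d :=
  smul_one_injective G (h.symm.trans h')

omit [G.LaxMonoidal] hε in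
theorem coproduct_induction [PreservesColimitsOfSize.{u, u} G] {T : Type u} (M : T → LimMod A)
    (P : G.obj (∐ M) → Prop) (h0 : P 0) (hadd : ∀ x y, P x → P y → P (x + y))
    (hι : ∀ t (x : G.obj (M t)), P (G.map (Sigma.ι M t) x)) (x : G.obj (∐ M)) : P x :=
  ModuleCat.cofan_induction _
    (isColimitCofanMkObjOfIsColimit G M _ (coproductIsCoproduct M)) P h0 hadd hι x

end

variable {A : AcceptableProAlgebra K} {S : CommAlgCat.{u} K} (G : LimMod A.alg ⥤ ModuleCat.{u} S)
  [G.LaxMonoidal] [G.Additive] [PreservesColimitsOfSize.{u, u} G]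

/-- A cocontinuous functor kills the endomorphisms of the unit that vanish at `X`, for
some `X`: otherwise a sequence of endomorphisms which converges to zero would give a morphism from
the unit to an infinite coproduct of units whose image has infinitely many nonzero components. -/
theorem exists_image_eq_zero :
    ∃ X, ∀ a : 𝟙_ (LimMod A.alg) ⟶ 𝟙_ (LimMod A.alg), ev a X = 0 → image G a = 0 := by
  by_contra! hcon
  obtain ⟨σ, hσ, -, hc⟩ :=
    exists_monotone_cofinal_seq A.countable_cofinal (Classical.arbitrary A.Index)
  choose a ha ha' using fun n : ℕ => hcon (op (σ n))
  let U : ULift.{u} ℕ → LimMod A.alg := fun _ => 𝟙_ _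
  let v : ℕ → (𝟙_ (LimMod A.alg) ⟶ ∐ U) := fun n => a n ≫ Sigma.ι U ⟨n⟩
  have hv {n : ℕ} {X : A.Indexᵒᵖ} (h : X.unop ≤ σ n) : ev (v n) X = 0 := by
    have : ev (a n) X = 0 := by
      rw [← trans_ev (a n) (homOfLE h).op, ha, trans_zero]
    rw [ev_comp, this]
    exact map_zero ((proj A.alg X).map _).hom
  choose N hN using hc
  -- The infinite sum of the `v n`. At `X` the terms with `n ≥ N X` vanish, since then `X ≤ σ n`, so
  -- the truncations are compatible and define a section of the coproduct.
  obtain ⟨s, hs⟩ := exists_ev_eq (M := ∐ U)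
    (fun X => ∑ n ∈ Finset.range (N X.unop), ev (v n) X) (fun X Y t => by
      have h₁ : (∐ U).trans t (∑ n ∈ Finset.range (N X.unop), ev (v n) X) =
          ∑ n ∈ Finset.range (N X.unop), ev (v n) Y := by
        refine (map_sum ((∐ U).obj.map t).hom _ _).trans (Finset.sum_congr rfl fun n _ => ?_)
        exact trans_ev (v n) t
      rw [h₁]
      rcases le_total (N X.unop) (N Y.unop) with h | h
      · refine Finset.sum_subset (Finset.range_mono h) fun n _ hn => hv ?_
        exact t.unop.le.trans ((hN _).trans (hσ (by simpa using hn)))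
      · refine (Finset.sum_subset (Finset.range_mono h) fun n _ hn => hv ?_).symm
        exact (hN _).trans (hσ (by simpa using hn)))
  let π : ℕ → (∐ U ⟶ 𝟙_ _) := fun m => Sigma.desc fun n => if n.down = m then 𝟙 _ else 0
  have hιπ (n : ULift.{u} ℕ) (m : ℕ) :
      Sigma.ι U n ≫ π m = if n.down = m then 𝟙 _ else 0 := Sigma.ι_desc _ _
  have hsπ (m : ℕ) : s ≫ π m = a m := ev_ext fun X => by
    rw [ev_comp, hs]
    refine (map_sum ((proj A.alg X).map (π m)).hom _ _).trans ?_
    have h₁ (n : ℕ) : ((proj A.alg X).map (π m)).hom (ev (v n) X) =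
        if n = m then ev (a m) X else 0 := by
      refine (ev_comp (v n) (π m) X).symm.trans ?_
      rw [Category.assoc, hιπ]
      split_ifs with h
      · obtain rfl : n = m := h
        rw [Category.comp_id]
      · rw [comp_zero]
        rfl
    rw [Finset.sum_congr rfl fun n _ => h₁ n, Finset.sum_ite_eq']
    split_ifs with h
    · rfl
    · rw [← trans_ev (a m) (homOfLE ((hN X.unop).trans (hσ (by simpa using h)))).op, ha,
        trans_zero]
  -- `G` preserves the coproduct, so any element of `G (∐ U)` is a finite sum from the summands and
  -- has only finitely many nonzero coordinates. The `B`-th coordinate of the image of `s` is the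
  -- image of `a B`, a contradiction.
  obtain ⟨B, hB⟩ : ∃ B, ∀ m, B ≤ m → G.map (π m) (image G s) = 0 := by
    refine coproduct_induction G U (fun x => ∃ B, ∀ m, B ≤ m → G.map (π m) x = 0) ?_ ?_ ?_ _
    · exact ⟨0, fun m _ => map_zero (G.map (π m)).hom⟩
    · rintro x y ⟨B, hB⟩ ⟨B', hB'⟩
      refine ⟨max B B', fun m hm => (map_add (G.map (π m)).hom x y).trans ?_⟩
      exact (congrArg₂ (· + ·) (hB m (le_of_max_le_left hm)) (hB' m (le_of_max_le_right hm))).trans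
        (add_zero _)
    · intro n x
      refine ⟨n.down + 1, fun m hm => ?_⟩
      refine congr($((G.map_comp (Sigma.ι U n) (π m)).symm) x).trans ?_
      rw [hιπ, if_neg (by omega), G.map_zero]
      rfl
  refine ha' B ?_
  rw [← hsπ, ← map_image, hB B le_rfl]

end LimMod

/-! ### The scalars of a tensor functor, and factorization through one index -/

namespace LimMod

open Functor.LaxMonoidal

variable {K : Type u} [CommRing K]

section

variable {I : Type u} [Category.{u} I] {A : Iᵒᵖ ⥤ CommAlgCat.{u} K} {S : CommAlgCat.{u} K}

/-- Multiplication by an endomorphism of the unit on an object. -/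
noncomputable def act (a : 𝟙_ (LimMod A) ⟶ 𝟙_ (LimMod A)) (M : LimMod A) : M ⟶ M :=
  (λ_ M).inv ≫ a ▷ M ≫ (λ_ M).hom

theorem proj_map_act (a : 𝟙_ (LimMod A) ⟶ 𝟙_ (LimMod A)) (M : LimMod A) (X : Iᵒᵖ)
    (m : (proj A X).obj M) :
    (proj A X).map (act a M) m = (show A.obj X from ev a X) • m := rfl

/-- The value at `X` of an endomorphism of the unit, as an element of the algebra `A X`. -/
noncomputable def val (a : 𝟙_ (LimMod A) ⟶ 𝟙_ (LimMod A)) (X : Iᵒᵖ) : A.obj X := ev a X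

theorem map_val (a : 𝟙_ (LimMod A) ⟶ 𝟙_ (LimMod A)) {X Y : Iᵒᵖ} (t : X ⟶ Y) :
    (A.map t).hom (val a X) = val a Y := trans_ev a t

theorem val_id (X : Iᵒᵖ) : val (𝟙 (𝟙_ (LimMod A))) X = 1 := rfl

theorem val_comp (a b : 𝟙_ (LimMod A) ⟶ 𝟙_ (LimMod A)) (X : Iᵒᵖ) :
    val (a ≫ b) X = val a X * val b X := ev_smul a b X

theorem val_add (a b : 𝟙_ (LimMod A) ⟶ 𝟙_ (LimMod A)) (X : Iᵒᵖ) :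
    val (a + b) X = val a X + val b X := rfl

theorem val_smul_id (c : K) (X : Iᵒᵖ) :
    val (c • 𝟙 (𝟙_ (LimMod A))) X = algebraMap K (A.obj X) c := by
  refine Eq.trans ?_ (mul_one (algebraMap K (A.obj X) c))
  rfl

theorem ev_comp_eq_val_smul (a : 𝟙_ (LimMod A) ⟶ 𝟙_ (LimMod A)) {M : LimMod A}
    (s : 𝟙_ (LimMod A) ⟶ M) (X : Iᵒᵖ) : ev (a ≫ s) X = val a X • ev s X :=
  ev_smul a s X

variable (G : LimMod A ⥤ ModuleCat.{u} S) [G.LaxMonoidal]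

theorem HasScalar.id : HasScalar G (𝟙 (𝟙_ (LimMod A))) 1 :=
  (image_id G).trans (one_smul S _).symm

variable {G} in
theorem HasScalar.image_comp {a : 𝟙_ (LimMod A) ⟶ 𝟙_ (LimMod A)} {c : S} (h : HasScalar G a c)
    {M : LimMod A} (s : 𝟙_ (LimMod A) ⟶ M) : image G (a ≫ s) = c • image G s := by
  rw [← map_image]
  exact (congrArg (G.map s) h).trans (map_smul (G.map s).hom c _)

variable {G} in
theorem HasScalar.comp {a b : 𝟙_ (LimMod A) ⟶ 𝟙_ (LimMod A)} {c d : S} (h : HasScalar G a c)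
    (h' : HasScalar G b d) : HasScalar G (a ≫ b) (c * d) :=
  (h.image_comp b).trans ((congrArg (c • ·) h').trans (mul_smul c d _).symm)

variable {G} in
theorem HasScalar.add [G.Additive] {a b : 𝟙_ (LimMod A) ⟶ 𝟙_ (LimMod A)} {c d : S}
    (h : HasScalar G a c) (h' : HasScalar G b d) : HasScalar G (a + b) (c + d) :=
  (image_add G a b).trans ((congrArg₂ (· + ·) h h').trans (add_smul c d _).symm)

theorem HasScalar.smul_id [G.Additive] [G.Linear K] (c : K) :
    HasScalar G (c • 𝟙 (𝟙_ (LimMod A))) (algebraMap K S c) :=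
  (image_smul G c (𝟙 _)).trans (congrArg (algebraMap K S c • ·) (image_id G))

/-- `g : A_X ⟶ S` describes the scalars by which `G` acts on the endomorphisms of the unit. -/
def IsScalarHom {X : Iᵒᵖ} (g : A.obj X ⟶ S) : Prop :=
  ∀ a : 𝟙_ (LimMod A) ⟶ 𝟙_ (LimMod A), HasScalar G a (g.hom (val a X))

variable {G} in
theorem IsScalarHom.image_eq_zero {X : Iᵒᵖ} {g : A.obj X ⟶ S} (h : IsScalarHom G g)
    (a : 𝟙_ (LimMod A) ⟶ 𝟙_ (LimMod A)) (ha : ev a X = 0) : image G a = 0 := by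
  have hv : val a X = 0 := ha
  have := h a
  rw [hv, map_zero] at this
  exact this.trans (zero_smul S _)

variable [IsIso (ε G)] [∀ M N, IsIso (μ G M N)]

theorem map_act_eq_zero [G.Additive] (a : 𝟙_ (LimMod A) ⟶ 𝟙_ (LimMod A)) (ha : image G a = 0)
    (M : LimMod A) : G.map (act a M) = 0 := by
  have h : G.map a = 0 := by
    rw [← cancel_epi (ε G), comp_zero]
    refine ModuleCat.hom_ext (LinearMap.ext fun c => ?_)
    refine (congrArg (G.map a) (ε_apply G c)).trans ?_
    refine (map_smul (G.map a).hom c (ε G (1 : S))).trans ?_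
    exact (congrArg (c • ·) ha).trans (smul_zero c)
  have h' : G.map (a ▷ M) = 0 := by
    rw [← cancel_epi (μ G _ M), ← μ_natural_left, h, MonoidalPreadditive.zero_whiskerRight,
      zero_comp, comp_zero]
  rw [act, G.map_comp, G.map_comp, h', zero_comp, comp_zero]

end

variable {A : AcceptableProAlgebra K} {S : CommAlgCat.{u} K} (G : LimMod A.alg ⥤ ModuleCat.{u} S)
  [G.LaxMonoidal] [G.Additive] [PreservesColimitsOfSize.{u, u} G] [IsIso (ε G)]

omit [G.Additive] in
/-- The images of the sections of `M` generate `G M`. -/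
theorem image_induction {M : LimMod A.alg} (P : G.obj M → Prop) (h0 : P 0)
    (hadd : ∀ x y, P x → P y → P (x + y))
    (hs : ∀ (c : S) (s : 𝟙_ (LimMod A.alg) ⟶ M), P (c • image G s)) (x : G.obj M) : P x := by
  let p := ofSections fun s : (𝟙_ (LimMod A.alg) ⟶ M) => s
  have := epi_of_surjective p (ofSections_surjective M)
  have : PreservesFiniteColimits G := PreservesColimitsOfSize.preservesFiniteColimits.{u, u} G
  obtain ⟨x, rfl⟩ := (ModuleCat.epi_iff_surjective (G.map p)).1 inferInstance x
  refine coproduct_induction G _ (fun x => P (G.map p x)) ?_ ?_ ?_ x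
  · exact (map_zero (G.map p).hom).symm ▸ h0
  · exact fun x y hx hy => (map_add (G.map p).hom x y).symm ▸ hadd _ _ hx hy
  · intro s y
    obtain ⟨c, rfl⟩ := ((ConcreteCategory.isIso_iff_bijective (ε G)).1 inferInstance).2 y
    refine (congrArg P ?_).mpr (hs c s)
    refine (congrArg (fun y => G.map p (G.map _ y)) (ε_apply G c)).trans ?_
    refine (congrArg (G.map p) (map_smul (G.map _).hom c (ε G (1 : S)))).trans ?_
    refine (map_smul (G.map p).hom c _).trans (congrArg (c • ·) ?_)
    refine (map_image G _ p).trans (congrArg (image G) ?_)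
    exact Sigma.ι_desc _ _

variable [∀ M N, IsIso (μ G M N)]

/-- This passes from endomorphisms of the unit to arbitrary sections. Dividing `M` by the action of
all endomorphisms vanishing at `X` does not change `G M`, as `G` turns these actions into zero and
preserves cokernels; but it kills every section vanishing at `X`. -/
theorem image_eq_zero {X : A.Indexᵒᵖ}
    (hX : ∀ a : 𝟙_ (LimMod A.alg) ⟶ 𝟙_ (LimMod A.alg), ev a X = 0 → image G a = 0)
    {M : LimMod A.alg} (s : 𝟙_ (LimMod A.alg) ⟶ M) (hs : ev s X = 0) : image G s = 0 := by
  let T := { a : 𝟙_ (LimMod A.alg) ⟶ 𝟙_ (LimMod A.alg) // ev a X = 0 }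
  let θ : (∐ fun _ : T => M) ⟶ M := Sigma.desc fun a => act a.1 M
  have hθ (a : T) : Sigma.ι (fun _ : T => M) a ≫ θ = act a.1 M := Sigma.ι_desc _ _
  have hGθ : G.map θ = 0 := ModuleCat.hom_ext (LinearMap.ext fun x => by
    refine coproduct_induction G _ (fun x => G.map θ x = 0) (map_zero (G.map θ).hom)
      (fun x y hx hy => (map_add (G.map θ).hom x y).trans ?_) (fun a y => ?_) x
    · exact (congrArg₂ (· + ·) hx hy).trans (add_zero _)
    · refine congr($((G.map_comp _ θ).symm) y).trans ?_
      rw [hθ, map_act_eq_zero G _ (hX _ a.2)]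
      rfl)
  -- Work at an index `k` above both `X` and `Y`: there the value of `s` lies in `ker (A_k ⟶ A_X) •
  -- M_k`, and each scalar in that kernel lifts to an endomorphism of the unit vanishing at `X`.
  have hsπ : s ≫ cokernel.π θ = 0 := ev_ext fun Y => by
    obtain ⟨k, hk, hk'⟩ := exists_ge_ge X.unop Y.unop
    let tX : op k ⟶ X := (homOfLE hk).op
    have h : (proj A.alg (op k)).map (cokernel.π θ) (ev s (op k)) = 0 := by
      have hm := M.mem_ker_smul_of_trans_eq_zero tX (alg_map_surjective tX) (ev s (op k))
        ((trans_ev s tX).trans hs)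
      refine Submodule.smul_induction_on hm (fun r hr m _ => ?_) (fun x y hx hy => ?_)
      · obtain ⟨a, ha⟩ := exists_ev (𝟙_ (LimMod A.alg)) (op k) r
        have ha' : ev a X = 0 := by
          rw [← trans_ev a tX, ha]
          exact hr
        have h₁ : (proj A.alg (op k)).map (act a M) m = r • m := by
          rw [proj_map_act, ha]
        rw [← h₁, ← hθ ⟨a, ha'⟩, ← proj_map_comp_apply, Category.assoc, cokernel.condition,
          comp_zero]
        rfl
      · exact (map_add ((proj A.alg (op k)).map (cokernel.π θ)).hom x y).trans
          ((congrArg₂ (· + ·) hx hy).trans (add_zero _))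
    rw [ev_comp, ← trans_ev s (homOfLE hk').op, map_trans, h, trans_zero]
    rfl
  have : PreservesFiniteColimits G := PreservesColimitsOfSize.preservesFiniteColimits.{u, u} G
  have : IsIso (G.map (cokernel.π θ)) :=
    CokernelCofork.IsColimit.isIso_π _
      (isColimitCoforkMapOfIsColimit' G (cokernel.condition θ) (cokernelIsCokernel θ)) hGθ
  refine ((ConcreteCategory.isIso_iff_bijective (G.map (cokernel.π θ))).1 this).1 ?_
  rw [map_image, hsπ, image_zero]
  exact (map_zero (G.map (cokernel.π θ)).hom).symm

omit [∀ M N, IsIso (μ G M N)] in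
-- `End(1) ⟶ A_X` is surjective, and for the `X` of `exists_image_eq_zero` its kernel acts by zero
-- on `G 1`; hence the homomorphism `End(1) ⟶ S` descends to `A_X`.
theorem exists_isScalarHom [G.Linear K] :
    ∃ (i : A.Index) (g : A.alg.obj (op i) ⟶ S), IsScalarHom G g := by
  obtain ⟨X, hX⟩ := exists_image_eq_zero G
  obtain ⟨a, ha⟩ : ∃ a : A.alg.obj X → (𝟙_ (LimMod A.alg) ⟶ 𝟙_ (LimMod A.alg)),
      ∀ r, val (a r) X = r :=
    ⟨_, fun r => (exists_ev (𝟙_ (LimMod A.alg)) X r).choose_spec⟩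
  choose g hg using fun r => exists_hasScalar G (a r)
  -- The lifts `a r` are arbitrary. Here the scalar of any endomorphism is shown to depend only on
  -- its value at `X`, so each algebra law for `g` follows from the same law for scalars.
  have key {b : 𝟙_ (LimMod A.alg) ⟶ 𝟙_ (LimMod A.alg)} {c : S} (h : HasScalar G b c) :
      g (val b X) = c := by
    refine HasScalar.unique G (hg _) (Eq.trans ?_ h)
    have := hX (a (val b X) - b) (sub_eq_zero.2 (ha (val b X)))
    rwa [image_sub, sub_eq_zero] at this
  refine ⟨X.unop, CommAlgCat.ofHom (AlgHom.ofLinearMap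
    { toFun := g
      map_add' := fun r r' => ?_
      map_smul' := fun c r => ?_ } ?_ fun r r' => ?_), fun b => ?_⟩
  · have := key ((hg r).add (hg r'))
    rwa [val_add, ha, ha] at this
  · have := key ((HasScalar.smul_id G c).comp (hg r))
    rwa [val_comp, ha, val_smul_id, ← Algebra.smul_def, ← Algebra.smul_def] at this
  · have := key (HasScalar.id G)
    rwa [val_id] at this
  · have := key ((hg r).comp (hg r'))
    rwa [val_comp, ha, ha] at this
  · obtain ⟨c, hc⟩ := exists_hasScalar G b
    have := key hc
    change HasScalar G b (g (val b X))
    rwa [this]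

end LimMod

/-- Morphisms out of an extension of scalars are determined by the images of the `1 ⊗ m`. -/
theorem ModuleCat.extendScalars_hom_ext {R S : Type u} [CommRing R] [CommRing S] {f : R →+* S}
    {M : ModuleCat.{u} R} {N : ModuleCat.{u} S} {α β : (extendScalars.{u, u, u} f).obj M ⟶ N}
    (h : ∀ m : M, α ((1 : S) ⊗ₜ[R, f] m) = β ((1 : S) ⊗ₜ[R, f] m)) : α = β :=
  ((extendRestrictScalarsAdj f).homEquiv M N).injective
    (ModuleCat.hom_ext (LinearMap.ext h))

/-! ### Tensor functors to modules are base changes -/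

namespace LimMod

open Functor.LaxMonoidal

variable {K : Type u} [CommRing K]

/-- The functor `M ↦ S ⊗_{A_X} M_X` given by an algebra homomorphism `A_X ⟶ S`. -/
noncomputable abbrev pullback {I : Type u} [Category.{u} I] {A : Iᵒᵖ ⥤ CommAlgCat.{u} K}
    {S : CommAlgCat.{u} K} {X : Iᵒᵖ} (g : A.obj X ⟶ S) : LimMod A ⥤ ModuleCat.{u} S :=
  proj A X ⋙ ModuleCat.extendScalars.{u, u, u} g.hom.toRingHom

section

variable {I : Type u} [Category.{u} I] {A : Iᵒᵖ ⥤ CommAlgCat.{u} K} {S : CommAlgCat.{u} K}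
  {X : Iᵒᵖ}

theorem isScalarHom_pullback (g : A.obj X ⟶ S) : IsScalarHom (pullback g) g := by
  intro a
  let := g.hom.toRingHom.toAlgebra
  change (1 : S) ⊗ₜ[A.obj X] (val a X) = (g.hom (val a X)) • ((1 : S) ⊗ₜ[A.obj X] (1 : A.obj X))
  rw [TensorProduct.smul_tmul', smul_eq_mul, mul_one]
  refine Eq.trans ?_ ((TensorProduct.smul_tmul (val a X) (1 : S) (1 : A.obj X)).symm.trans ?_)
  · rw [smul_eq_mul, mul_one]
  · rw [Algebra.smul_def, mul_one]
    rfl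

/-- A monoidal transformation sends images of sections to images of sections. -/
theorem app_image {G G' : LimMod A ⥤ ModuleCat.{u} S} [G.LaxMonoidal] [G'.LaxMonoidal] (η : G ⟶ G')
    [NatTrans.IsMonoidal η] {M : LimMod A} (s : 𝟙_ (LimMod A) ⟶ M) :
    η.app M (image G s) = image G' s := by
  refine congr($(η.naturality s) (ε G (1 : S))).trans ?_
  exact congrArg (G'.map s) congr($(NatTrans.IsMonoidal.unit (τ := η)) (1 : S))

theorem IsScalarHom.of_isMonoidal {G G' : LimMod A ⥤ ModuleCat.{u} S} [G.LaxMonoidal]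
    [G'.LaxMonoidal] (η : G ⟶ G') [NatTrans.IsMonoidal η] {g : A.obj X ⟶ S}
    (h : IsScalarHom G g) : IsScalarHom G' g := by
  intro a
  have h₁ := app_image η a
  rw [h a] at h₁
  refine h₁.symm.trans ((map_smul (η.app _).hom _ _).trans (congrArg _ ?_))
  exact congr($(NatTrans.IsMonoidal.unit (τ := η)) (1 : S))

end

variable {A : AcceptableProAlgebra K} {S : CommAlgCat.{u} K}

/-- Compatibility with the units forces the values on images of sections, and these generate `G M`.
-/
theorem app_eq_of_isMonoidal {G G' : LimMod A.alg ⥤ ModuleCat.{u} S}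
    [G.LaxMonoidal] [PreservesColimitsOfSize.{u, u} G] [IsIso (ε G)] [G'.LaxMonoidal]
    (η η' : G ⟶ G') [NatTrans.IsMonoidal η] [NatTrans.IsMonoidal η'] : η = η' := by
  refine NatTrans.ext (funext fun M => ModuleCat.hom_ext (LinearMap.ext fun x => ?_))
  refine image_induction G (fun x => η.app M x = η'.app M x) ?_ ?_ ?_ x
  · exact (map_zero (η.app M).hom).trans (map_zero (η'.app M).hom).symm
  · intro x y hx hy
    exact (map_add (η.app M).hom x y).trans
      ((congrArg₂ (· + ·) hx hy).trans (map_add (η'.app M).hom x y).symm)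
  · intro c s
    refine (map_smul (η.app M).hom c _).trans (Eq.trans (congrArg (c • ·) ?_)
      (map_smul (η'.app M).hom c _).symm)
    exact (app_image η s).trans (app_image η' s).symm

variable (G : LimMod A.alg ⥤ ModuleCat.{u} S)
  [G.LaxMonoidal] [G.Additive] [PreservesColimitsOfSize.{u, u} G] [IsIso (ε G)]
  [∀ M N, IsIso (μ G M N)] {X : A.Indexᵒᵖ} {g : A.alg.obj X ⟶ S}

theorem image_eq_of_ev_eq (hg : IsScalarHom G g) {M : LimMod A.alg}
    {s t : 𝟙_ (LimMod A.alg) ⟶ M} (h : ev s X = ev t X) : image G s = image G t := by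
  have := image_eq_zero G (X := X) hg.image_eq_zero (s - t) (by rw [ev_sub, h, sub_self])
  rwa [image_sub, sub_eq_zero] at this

/-- Send `1 ⊗ m` to the image of any section through `m`; by `image_eq_of_ev_eq` the choice of the
section is irrelevant, which yields semilinearity. -/
theorem exists_pullback_app (hg : IsScalarHom G g) (M : LimMod A.alg) :
    ∃ f : (pullback g).obj M ⟶ G.obj M, ∀ s : 𝟙_ (LimMod A.alg) ⟶ M,
      f (image (pullback g) s) = image G s := by
  choose σ hσ using exists_ev M X
  have hadd (m n : (proj A.alg X).obj M) :
      image G (σ (m + n)) = image G (σ m) + image G (σ n) := by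
    rw [← image_add]
    exact image_eq_of_ev_eq G hg (by rw [ev_add, hσ, hσ, hσ])
  have hsmul (r : A.alg.obj X) (m : (proj A.alg X).obj M) :
      image G (σ (r • m)) = g.hom r • image G (σ m) := by
    obtain ⟨a, rfl⟩ : ∃ a : 𝟙_ (LimMod A.alg) ⟶ 𝟙_ (LimMod A.alg), val a X = r :=
      exists_ev (𝟙_ (LimMod A.alg)) X r
    rw [← (hg a).image_comp]
    exact image_eq_of_ev_eq G hg (by rw [ev_comp_eq_val_smul, hσ, hσ])
  let f₀ : (proj A.alg X).obj M ⟶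
      (ModuleCat.restrictScalars g.hom.toRingHom).obj (G.obj M) := ModuleCat.ofHom
    (Y := (ModuleCat.restrictScalars g.hom.toRingHom).obj (G.obj M))
    { toFun m := image G (σ m)
      map_add' := hadd
      map_smul' := hsmul }
  refine ⟨((ModuleCat.extendRestrictScalarsAdj g.hom.toRingHom).homEquiv _ _).symm f₀,
    fun s => ?_⟩
  refine (one_smul S _).trans ?_
  exact image_eq_of_ev_eq G hg (hσ _)

theorem pullback_hom_ext {M : LimMod A.alg} {N : ModuleCat.{u} S} {f f' : (pullback g).obj M ⟶ N}
    (h : ∀ s : 𝟙_ (LimMod A.alg) ⟶ M, f (image (pullback g) s) = f' (image (pullback g) s)) :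
    f = f' := by
  refine ModuleCat.extendScalars_hom_ext fun m => ?_
  obtain ⟨s, rfl⟩ := exists_ev M X m
  exact h s

/-- A tensor functor to the category of modules over `S` whose scalars are given by `A_X ⟶ S` is
isomorphic to the functor `M ↦ S ⊗_{A_X} M_X`. -/
theorem exists_pullback_iso (hg : IsScalarHom G g) :
    ∃ e : pullback g ≅ G, NatTrans.IsMonoidal e.hom := by
  choose f hf using exists_pullback_app G hg
  let η : pullback g ⟶ G :=
    { app := f
      naturality M N φ := pullback_hom_ext fun s => by
        have h₁ : (pullback g).map φ (image (pullback g) s) = image (pullback g) (s ≫ φ) :=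
          map_image _ _ _
        have h₂ : G.map φ (image G s) = image G (s ≫ φ) := map_image _ _ _
        exact (congrArg (f N) h₁).trans ((hf N _).trans (h₂.symm.trans
          (congrArg (G.map φ) (hf M s).symm))) }
  -- Both unit maps are isomorphisms, so this makes `η` invertible at the unit and hence everywhere
  -- by cocontinuity.
  have hε : ε (pullback g) ≫ η.app (𝟙_ _) = ε G := by
    refine ModuleCat.hom_ext (LinearMap.ext fun c => ?_)
    refine Eq.trans ?_ (ε_apply G c).symm
    refine (congrArg (f (𝟙_ _)) (ε_apply (pullback g) c)).trans ?_
    refine (map_smul (f (𝟙_ _)).hom c _).trans (congrArg (c • ·) ?_)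
    rw [← image_id, ← image_id]
    exact hf _ _
  have : IsIso (η.app (𝟙_ (LimMod A.alg))) := by
    have : IsIso (ε (pullback g) ≫ η.app (𝟙_ _)) := by
      rw [hε]
      infer_instance
    exact IsIso.of_isIso_comp_left (ε (pullback g)) _
  have (M : LimMod A.alg) : IsIso (η.app M) := isIso_app_of_isIso_app_unit η M
  have : IsIso η := NatIso.isIso_of_isIso_app η
  refine ⟨asIso η, ⟨hε, fun M N => ?_⟩⟩
  rw [← cancel_epi (Functor.OplaxMonoidal.δ (pullback g) M N), Functor.Monoidal.δ_μ_assoc]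
  refine ((ModuleCat.extendRestrictScalarsAdj g.hom.toRingHom).homEquiv _ _).injective
    (ModuleCat.MonoidalCategory.tensor_ext fun m n => ?_)
  obtain ⟨s, rfl⟩ := exists_ev M X m
  obtain ⟨t, rfl⟩ := exists_ev N X n
  refine (hf _ (tensorSection s t)).trans ((image_tensorSection G s t).trans ?_)
  exact congrArg₂ (fun x y => μ G M N (x ⊗ₜ[S] y)) (hf M s).symm (hf N t).symm

end LimMod

namespace CategoryTheory.Functor.LaxMonoidal

variable {C D E : Type*} [Category* C] [Category* D] [Category* E] [MonoidalCategory C]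
  [MonoidalCategory D] [MonoidalCategory E] (F : C ⥤ D) (G : D ⥤ E) [F.LaxMonoidal] [G.LaxMonoidal]

instance [IsIso (ε F)] [IsIso (ε G)] : IsIso (ε (F ⋙ G)) := by
  rw [comp_ε]
  infer_instance

instance [∀ X Y, IsIso (μ F X Y)] [∀ X Y, IsIso (μ G X Y)] (X Y : C) : IsIso (μ (F ⋙ G) X Y) := by
  rw [comp_μ]
  infer_instance

end CategoryTheory.Functor.LaxMonoidal

namespace TensorFunctor

open Functor.LaxMonoidal

variable {K : Type u} [CommRing K] {C D : Type (u + 1)} [Category.{u} C] [MonoidalCategory C]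
  [SymmetricCategory C] [Preadditive C] [Linear K C] [Category.{u} D] [MonoidalCategory D]
  [SymmetricCategory D] [Preadditive D] [Linear K D] (F : TensorFunctor K C D)

instance : IsIso (ε F.functor) := F.property.1

instance (X Y : C) : IsIso (μ F.functor X Y) := F.property.2.1 X Y

instance : F.functor.Additive := F.property.2.2.1

instance : Functor.Linear K F.functor := F.property.2.2.2.1

instance : PreservesColimitsOfSize.{u, u} F.functor := F.property.2.2.2.2

end TensorFunctor

/-! ### Inverse image functors are characterized by their scalars -/

namespace LimMod

open Functor.LaxMonoidal

variable {K : Type u} [CommRing K]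

section

variable {I : Type u} [PartialOrder I] [IsDirectedOrder I] {A : Iᵒᵖ ⥤ CommAlgCat.{u} K}
  {S S' : CommAlgCat.{u} K}

/-- The value of an endomorphism of the unit at an element of `colim_i hom(A_i, S)`. -/
noncomputable def scalar (x : ColimHom A S) (a : 𝟙_ (LimMod A) ⟶ 𝟙_ (LimMod A)) : S :=
  Quotient.lift (s := colimHomSetoid A S) (fun p => p.2.hom (val a (op p.1)))
    (by
      rintro ⟨i, g⟩ ⟨i', g'⟩ ⟨k, h, h', e⟩
      dsimp only at h h' e ⊢
      rw [← map_val a (homOfLE h).op, ← map_val a (homOfLE h').op]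
      exact congr(($e).hom (val a (op k)))) x

theorem scalar_comp (x : ColimHom A S) (g : S ⟶ S') (a : 𝟙_ (LimMod A) ⟶ 𝟙_ (LimMod A)) :
    scalar (x.comp g) a = g.hom (scalar x a) := by
  obtain ⟨i, f⟩ := x
  rfl

/-- The functor `G` acts on the endomorphisms of the unit by their values at `x`. -/
def HasScalars (G : LimMod A ⥤ ModuleCat.{u} S) [G.LaxMonoidal] (x : ColimHom A S) : Prop :=
  ∀ a : 𝟙_ (LimMod A) ⟶ 𝟙_ (LimMod A), HasScalar G a (scalar x a)

theorem IsScalarHom.hasScalars {G : LimMod A ⥤ ModuleCat.{u} S} [G.LaxMonoidal] {i : I}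
    {g : A.obj (op i) ⟶ S} (h : IsScalarHom G g) : HasScalars G (ColimHom.mk i g) := h

theorem HasScalars.isScalarHom {G : LimMod A ⥤ ModuleCat.{u} S} [G.LaxMonoidal] {x : ColimHom A S}
    (h : HasScalars G x) {i : I} {g : A.obj (op i) ⟶ S} (hg : ColimHom.mk i g = x) :
    IsScalarHom G g := by
  subst hg
  exact h

theorem HasScalars.of_isMonoidal {G G' : LimMod A ⥤ ModuleCat.{u} S} [G.LaxMonoidal]
    [G'.LaxMonoidal] (η : G ⟶ G') [NatTrans.IsMonoidal η] {x : ColimHom A S}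
    (h : HasScalars G x) : HasScalars G' x := by
  obtain ⟨i, g⟩ := x
  exact IsScalarHom.of_isMonoidal (X := op i) η h

theorem InverseImageData.hasScalars {G : LimMod A ⥤ ModuleCat.{u} S} [G.LaxMonoidal]
    {x : ColimHom A S} (D : InverseImageData A x G) : HasScalars G x := by
  obtain ⟨i, g⟩ := x
  have := D.isMonoidal i g rfl
  exact IsScalarHom.of_isMonoidal (X := op i) (D.iso i g rfl).hom (isScalarHom_pullback g)

end

variable {A B : AcceptableProAlgebra K} {S : CommAlgCat.{u} K}

/-- Two representatives, pulled back to a common index `k`, agree on all values at `k` of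
endomorphisms of the unit, and these values exhaust `A_k`. -/
theorem scalar_injective : Function.Injective (scalar (A := A.alg) (S := S)) := by
  rintro ⟨i, g⟩ ⟨i', g'⟩ h
  obtain ⟨k, hk, hk'⟩ := exists_ge_ge i i'
  refine Quotient.sound ⟨k, hk, hk', ?_⟩
  refine CommAlgCat.hom_ext (AlgHom.ext fun r => ?_)
  obtain ⟨a, rfl⟩ : ∃ a : 𝟙_ (LimMod A.alg) ⟶ 𝟙_ (LimMod A.alg), val a (op k) = r :=
    exists_ev (𝟙_ (LimMod A.alg)) (op k) r
  have := congrFun h a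
  change g.hom ((A.alg.map (homOfLE hk).op).hom (val a (op k))) =
    g'.hom ((A.alg.map (homOfLE hk').op).hom (val a (op k)))
  rw [map_val, map_val]
  exact this

theorem HasScalars.unique {G : LimMod A.alg ⥤ ModuleCat.{u} S} [G.LaxMonoidal] [IsIso (ε G)]
    {x y : ColimHom A.alg S} (h : HasScalars G x) (h' : HasScalars G y) : x = y :=
  scalar_injective (funext fun a => (h a).unique G (h' a))

section

variable (G : LimMod A.alg ⥤ ModuleCat.{u} S)
  [G.LaxMonoidal] [G.Additive] [PreservesColimitsOfSize.{u, u} G] [IsIso (ε G)]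

theorem exists_hasScalars [G.Linear K] : ∃ x, HasScalars G x := by
  obtain ⟨i, g, h⟩ := exists_isScalarHom G
  exact ⟨_, h.hasScalars⟩

variable [∀ M N, IsIso (μ G M N)]

/-- The isomorphisms for different representatives can be chosen independently: each sends images of
sections to images of sections, so they are automatically compatible. -/
theorem nonempty_inverseImageData {x : ColimHom A.alg S} (hx : HasScalars G x) :
    Nonempty (InverseImageData A.alg x G) := by
  choose e he using fun (i : A.Index) (g : A.alg.obj (op i) ⟶ S) (hg : ColimHom.mk i g = x) =>
    exists_pullback_iso G (hx.isScalarHom hg)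
  refine ⟨⟨e, he, fun {i k} h g hg M m => ?_⟩⟩
  obtain ⟨s, rfl⟩ := exists_ev M (op k) m
  rw [trans_ev]
  have := he i g hg
  have := he k _ ((ColimHom.mk_map h g).trans hg)
  exact (app_image (e k _ _).hom s).trans (app_image (e i g hg).hom s).symm

theorem isInverseImage_iff {x : ColimHom A.alg S} : IsInverseImage A.alg x G ↔ HasScalars G x :=
  ⟨fun ⟨D⟩ => InverseImageData.hasScalars D, nonempty_inverseImageData G⟩

end

theorem image_comp_proj (F : LimMod A.alg ⥤ LimMod B.alg) [F.LaxMonoidal] (X : B.Indexᵒᵖ)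
    {M : LimMod A.alg} (s : 𝟙_ (LimMod A.alg) ⟶ M) :
    image (F ⋙ proj B.alg X) s = ev (ε F ≫ F.map s) X := rfl

theorem trans_image (F : LimMod A.alg ⥤ LimMod B.alg) [F.LaxMonoidal] {X Y : B.Indexᵒᵖ} (t : X ⟶ Y)
    {M : LimMod A.alg} (s : 𝟙_ (LimMod A.alg) ⟶ M) :
    (F.obj M).trans t (image (F ⋙ proj B.alg X) s) = image (F ⋙ proj B.alg Y) s :=
  trans_ev (ε F ≫ F.map s) t

/-- Compatibility in `j` costs nothing, because the transition maps of `F M` also carry images of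
sections to images of sections. -/
theorem isProInverseImage_iff (φ : A ⟶ B) (F : LimMod A.alg ⥤ LimMod B.alg) [F.LaxMonoidal]
    [F.Additive] [PreservesColimitsOfSize.{u, u} F] [IsIso (ε F)] [∀ M N, IsIso (μ F M N)] :
    IsProInverseImage φ F ↔ ∀ j, HasScalars (F ⋙ proj B.alg (op j)) (ProHom.app φ j) := by
  refine ⟨fun ⟨D, _⟩ j => InverseImageData.hasScalars (D j), fun h => ?_⟩
  let D (j) := Classical.choice (nonempty_inverseImageData _ (h j))
  refine ⟨D, fun j j' h i g hg hg' M m => ?_⟩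
  obtain ⟨s, rfl⟩ := exists_ev M (op i) m
  have := (D j').isMonoidal i g hg
  have := (D j).isMonoidal i _ hg'
  refine (congrArg _ (app_image ((D j').iso i g hg).hom s)).trans ?_
  exact (trans_image F _ s).trans (app_image ((D j).iso i _ hg').hom s).symm

theorem isProInverseImage_id (A : AcceptableProAlgebra K) :
    IsProInverseImage (𝟙 A) (𝟭 (LimMod A.alg)) := by
  have : IsIso (ε (𝟭 (LimMod A.alg))) := inferInstanceAs (IsIso (𝟙 _))
  have (M N : LimMod A.alg) : IsIso (μ (𝟭 (LimMod A.alg)) M N) := inferInstanceAs (IsIso (𝟙 _))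
  rw [isProInverseImage_iff]
  intro j a
  exact (mul_one (val a (op j))).symm

theorem scalar_compColim (φ : ProHom A.alg B.alg) {a : 𝟙_ (LimMod A.alg) ⟶ 𝟙_ (LimMod A.alg)}
    {b : 𝟙_ (LimMod B.alg) ⟶ 𝟙_ (LimMod B.alg)} (h : ∀ j, scalar (φ.app j) a = val b (op j))
    (y : ColimHom B.alg S) : scalar (φ.compColim y) a = scalar y b := by
  obtain ⟨j, g⟩ := y
  refine (scalar_comp (φ.app j) g a).trans ?_
  rw [h]
  rfl

theorem IsProInverseImage.comp {C : AcceptableProAlgebra K} {φ : A ⟶ B} {ψ : B ⟶ C}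
    {F : TensorFunctor K (LimMod A.alg) (LimMod B.alg)}
    {G : TensorFunctor K (LimMod B.alg) (LimMod C.alg)}
    (hF : IsProInverseImage φ F.functor) (hG : IsProInverseImage ψ G.functor) :
    IsProInverseImage (φ ≫ ψ) (F.functor ⋙ G.functor) := by
  rw [isProInverseImage_iff] at hF hG ⊢
  intro l a
  -- `F` induces a map `End(1_A) ⟶ End(1_B)`, and `b` is the image of `a`. The scalars of `F` on `a`
  -- at `j` are the values of `b`, so the scalars of the composite on `a` are those of `G` on `b`.
  let b := ε F.functor ≫ F.functor.map a ≫ inv (ε F.functor)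
  have hb : b ≫ ε F.functor = ε F.functor ≫ F.functor.map a := by simp [b]
  have h (j) : scalar (ProHom.app φ j) a = val b (op j) := by
    refine smul_one_injective (F.functor ⋙ proj B.alg (op j)) ((hF j a).symm.trans ?_)
    rw [image_comp_proj, ← hb]
    exact ev_smul b _ _
  have h₁ : scalar (ProHom.app (φ ≫ ψ) l) a = scalar (ProHom.app ψ l) b :=
    scalar_compColim φ h (ProHom.app ψ l)
  rw [h₁]
  have h₂ := (hG l b).image_comp (ε F.functor)
  rw [hb] at h₂
  refine Eq.trans ?_ h₂
  rw [← map_image]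
  rfl

end LimMod

/-! ### Existence of inverse images over an algebra -/

namespace LimMod

open Functor.LaxMonoidal

variable {K : Type u} [CommRing K]

section

variable {I : Type u} [Category.{u} I] {A : Iᵒᵖ ⥤ CommAlgCat.{u} K} {S : CommAlgCat.{u} K}
  {X : Iᵒᵖ} (g : A.obj X ⟶ S)

instance : (pullback g).Additive where
  map_add {M N f f'} := ModuleCat.extendScalars_hom_ext fun m => by
    let := g.hom.toRingHom.toAlgebra
    exact TensorProduct.tmul_add (1 : S) ((proj A X).map f m) ((proj A X).map f' m)

instance : (pullback g).Linear K where
  map_smul {M N} f c := ModuleCat.extendScalars_hom_ext fun m => by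
    let := g.hom.toRingHom.toAlgebra
    refine (TensorProduct.smul_tmul (algebraMap K (A.obj X) c) (1 : S)
      ((proj A X).map f m)).symm.trans ?_
    refine Eq.trans ?_ (TensorProduct.smul_tmul' (R := A.obj X) (algebraMap K S c) (1 : S)
      ((proj A X).map f m)).symm
    congr 1
    rw [Algebra.smul_def]
    exact congrArg (· * (1 : S)) (g.hom.commutes c)

instance : PreservesColimitsOfSize.{u, u} (pullback g) :=
  have : PreservesColimitsOfSize.{u, u} (ModuleCat.extendScalars.{u, u, u} g.hom.toRingHom) :=
    (ModuleCat.extendRestrictScalarsAdj g.hom.toRingHom).leftAdjoint_preservesColimits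
  comp_preservesColimits _ _

end

variable {A : AcceptableProAlgebra K} {S : CommAlgCat.{u} K} {X : A.Indexᵒᵖ}

noncomputable instance (g : A.alg.obj X ⟶ S) : (pullback g).LaxBraided where
  braided M N := by
    rw [← cancel_epi (Functor.OplaxMonoidal.δ (pullback g) M N), Functor.Monoidal.δ_μ_assoc]
    refine ((ModuleCat.extendRestrictScalarsAdj g.hom.toRingHom).homEquiv _ _).injective
      (ModuleCat.MonoidalCategory.tensor_ext fun m n => ?_)
    obtain ⟨s, rfl⟩ := exists_ev M X m
    obtain ⟨t, rfl⟩ := exists_ev N X n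
    exact image_tensorSection (pullback g) t s

/-- The functor `M ↦ S ⊗_{A_X} M_X` as a tensor functor. -/
noncomputable def pullbackTensor (g : A.alg.obj X ⟶ S) :
    TensorFunctor K (LimMod A.alg) (ModuleCat.{u} S) :=
  ⟨.of (pullback g), inferInstanceAs (IsIso (ε (pullback g))),
    fun M N => inferInstanceAs (IsIso (μ (pullback g) M N)),
    inferInstanceAs (pullback g).Additive, inferInstanceAs ((pullback g).Linear K),
    inferInstanceAs (PreservesColimitsOfSize.{u, u} (pullback g))⟩

theorem exists_isInverseImage (x : ColimHom A.alg S) :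
    ∃ G : TensorFunctor K (LimMod A.alg) (ModuleCat.{u} S), IsInverseImage A.alg x G.functor := by
  obtain ⟨i, g⟩ := x
  refine ⟨pullbackTensor g, (isInverseImage_iff _).2 ?_⟩
  exact (isScalarHom_pullback g).hasScalars

section Glue

variable {I : Type u} [Category.{u} I] {B : Iᵒᵖ ⥤ CommAlgCat.{u} K}

/-- The semilinear map underlying a morphism from an extension of scalars. -/
noncomputable def semi {R R' : CommAlgCat.{u} K} {t : R ⟶ R'} {M : ModuleCat.{u} R}
    {N : ModuleCat.{u} R'} (E : (ModuleCat.extendScalars.{u, u, u} t.hom.toRingHom).obj M ⟶ N)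
    (m : M) : N :=
  E ((1 : R') ⊗ₜ[R, t.hom.toRingHom] m)

theorem semi_add {R R' : CommAlgCat.{u} K} {t : R ⟶ R'} {M : ModuleCat.{u} R}
    {N : ModuleCat.{u} R'} (E : (ModuleCat.extendScalars.{u, u, u} t.hom.toRingHom).obj M ⟶ N)
    (m n : M) : semi E (m + n) = semi E m + semi E n :=
  map_add (((ModuleCat.extendRestrictScalarsAdj t.hom.toRingHom).homEquiv _ _) E).hom m n

theorem semi_zero {R R' : CommAlgCat.{u} K} {t : R ⟶ R'} {M : ModuleCat.{u} R}
    {N : ModuleCat.{u} R'} (E : (ModuleCat.extendScalars.{u, u, u} t.hom.toRingHom).obj M ⟶ N) :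
    semi E (0 : M) = 0 :=
  map_zero (((ModuleCat.extendRestrictScalarsAdj t.hom.toRingHom).homEquiv _ _) E).hom

theorem semi_smul {R R' : CommAlgCat.{u} K} {t : R ⟶ R'} {M : ModuleCat.{u} R}
    {N : ModuleCat.{u} R'} (E : (ModuleCat.extendScalars.{u, u, u} t.hom.toRingHom).obj M ⟶ N)
    (r : R) (m : M) : semi E (r • m) = t.hom r • semi E m :=
  map_smul (((ModuleCat.extendRestrictScalarsAdj t.hom.toRingHom).homEquiv _ _) E).hom r m

/-- An object of `LimMod B` given by its components and transition isomorphisms. -/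
noncomputable def mkObj (N : ∀ X : Iᵒᵖ, ModuleCat.{u} (B.obj X))
    (E : ∀ {X Y : Iᵒᵖ} (t : X ⟶ Y),
      (ModuleCat.extendScalars.{u, u, u} (B.map t).hom.toRingHom).obj (N X) ≅ N Y)
    (hid : ∀ X (m : N X), semi (E (𝟙 X)).hom m = m)
    (hcomp : ∀ {X Y Z : Iᵒᵖ} (s : X ⟶ Y) (t : Y ⟶ Z) (m : N X),
      semi (E (s ≫ t)).hom m = semi (E t).hom (semi (E s).hom m)) : LimMod B where
  obj :=
    { obj := N
      map t := ((ModuleCat.extendRestrictScalarsAdj (B.map t).hom.toRingHom).homEquiv _ _) (E t).hom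
      map_id X := ModuleCat.hom_ext (LinearMap.ext (hid X))
      map_comp s t := ModuleCat.hom_ext (LinearMap.ext (hcomp s t)) }
  property X Y t := by
    have : IsIso (E t).hom := inferInstance
    refine (congrArg (fun f => IsIso f) ?_).mpr this
    exact Equiv.symm_apply_apply
      ((ModuleCat.extendRestrictScalarsAdj (B.map t).hom.toRingHom).homEquiv _ _) (E t).hom

end Glue

end LimMod

/-! ### Gluing inverse images along a morphism of pro-algebras -/

namespace LimMod

open Functor.LaxMonoidal

variable {K : Type u} [CommRing K] {A B : AcceptableProAlgebra K}

/-- Extending scalars along `t` turns base change along `g` into base change along `g ≫ t`. This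
agrees with base change along `g'` as soon as the scalars do, even if `X` and `Y` are not
comparable. -/
theorem exists_transition_iso {S S' : CommAlgCat.{u} K} {X Y : A.Indexᵒᵖ} {g : A.alg.obj X ⟶ S}
    {g' : A.alg.obj Y ⟶ S'} {t : S ⟶ S'} (h : IsScalarHom (pullback g') (g ≫ t)) :
    ∃ E : pullback g ⋙ ModuleCat.extendScalars.{u, u, u} t.hom.toRingHom ≅ pullback g',
      ∀ (M : LimMod A.alg) (s : 𝟙_ (LimMod A.alg) ⟶ M),
        semi (E.hom.app M) (image (pullback g) s) = image (pullback g') s := by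
  obtain ⟨e, he⟩ := exists_pullback_iso (pullback g') h
  refine ⟨Functor.isoWhiskerLeft (proj A.alg X)
    (ModuleCat.extendScalarsComp g.hom.toRingHom t.hom.toRingHom).symm ≪≫ e, fun M s => ?_⟩
  refine Eq.trans ?_ (app_image e.hom s)
  refine congrArg (e.hom.app M) ?_
  have h₁ := ModuleCat.extendScalarsComp_hom_app_one_tmul g.hom.toRingHom t.hom.toRingHom
    ((proj A.alg X).obj M) (ev s X)
  have h₂ := congr($((ModuleCat.extendScalarsComp g.hom.toRingHom t.hom.toRingHom).hom_inv_id_app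
    ((proj A.alg X).obj M))
      ((1 : S') ⊗ₜ[A.alg.obj X, t.hom.toRingHom.comp g.hom.toRingHom] ev s X))
  refine Eq.trans ?_ h₂
  exact congrArg ((ModuleCat.extendScalarsComp g.hom.toRingHom t.hom.toRingHom).inv.app
    ((proj A.alg X).obj M)) h₁.symm

/-- A compatible family of algebra homomorphisms `A_{a X} ⟶ B_X`, together with the transition
isomorphisms of the functors `M ↦ B_X ⊗ M_{a X}`. -/
structure GluingData (A B : AcceptableProAlgebra K) where
  index : B.Indexᵒᵖ → A.Indexᵒᵖ
  map (X : B.Indexᵒᵖ) : A.alg.obj (index X) ⟶ B.alg.obj X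
  iso {X Y : B.Indexᵒᵖ} (t : X ⟶ Y) :
    pullback (map X) ⋙ ModuleCat.extendScalars.{u, u, u} (B.alg.map t).hom.toRingHom ≅
      pullback (map Y)
  iso_image {X Y : B.Indexᵒᵖ} (t : X ⟶ Y) (M : LimMod A.alg) (s : 𝟙_ (LimMod A.alg) ⟶ M) :
    semi ((iso t).hom.app M) (image (pullback (map X)) s) = image (pullback (map Y)) s

namespace GluingData

variable (D : GluingData A B)

theorem semi_smul_image {X Y : B.Indexᵒᵖ} (t : X ⟶ Y) {M : LimMod A.alg} (c : B.alg.obj X)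
    (s : 𝟙_ (LimMod A.alg) ⟶ M) :
    semi ((D.iso t).hom.app M) (c • image (pullback (D.map X)) s) =
      (B.alg.map t).hom c • image (pullback (D.map Y)) s := by
  rw [← D.iso_image t M s]
  exact semi_smul _ _ _

/-- The family of the modules `B_X ⊗ M_{a X}`. -/
noncomputable def obj (M : LimMod A.alg) : LimMod B.alg :=
  mkObj (fun X => (pullback (D.map X)).obj M) (fun t => (D.iso t).app M)
    (fun X m => by
      refine image_induction (pullback (D.map X))
        (fun m => semi ((D.iso (𝟙 X)).hom.app M) m = m) ?_ ?_ ?_ m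
      · exact semi_zero _
      · exact fun x y hx hy => (semi_add _ _ _).trans (congrArg₂ (· + ·) hx hy)
      · intro c s
        refine (D.semi_smul_image _ c s).trans ?_
        rw [B.alg.map_id]
        rfl)
    (fun {X Y Z} r t m => by
      refine image_induction (pullback (D.map X)) (fun m => semi ((D.iso (r ≫ t)).hom.app M) m =
        semi ((D.iso t).hom.app M) (semi ((D.iso r).hom.app M) m)) ?_ ?_ ?_ m
      · refine (semi_zero _).trans (Eq.trans (semi_zero _).symm (congrArg _ (semi_zero _).symm))
      · intro x y hx hy
        refine (semi_add _ _ _).trans ((congrArg₂ (· + ·) hx hy).trans ?_)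
        exact (semi_add _ _ _).symm.trans (congrArg _ (semi_add _ _ _).symm)
      · intro c s
        refine (D.semi_smul_image _ c s).trans ?_
        refine Eq.trans ?_ (congrArg _ (D.semi_smul_image r c s).symm)
        refine Eq.trans ?_ (D.semi_smul_image t _ s).symm
        rw [B.alg.map_comp]
        rfl)

theorem trans_image (M : LimMod A.alg) {X Y : B.Indexᵒᵖ} (t : X ⟶ Y)
    (s : 𝟙_ (LimMod A.alg) ⟶ M) :
    (D.obj M).trans t (image (pullback (D.map X)) s) = image (pullback (D.map Y)) s :=
  D.iso_image t M s

/-- The functor `M ↦ (B_X ⊗ M_{a X})_X`. -/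
noncomputable def functor : LimMod A.alg ⥤ LimMod B.alg where
  obj := D.obj
  map f := mkHom (fun X => (pullback (D.map X)).map f) (fun X Y t m =>
    congr($((D.iso t).hom.naturality f)
      ((1 : B.alg.obj Y) ⊗ₜ[B.alg.obj X, (B.alg.map t).hom.toRingHom] m)).symm)
  map_id M := hom_ext_apply fun X m => congr($((pullback (D.map X)).map_id M) m)
  map_comp f f' := hom_ext_apply fun X m => congr($((pullback (D.map X)).map_comp f f') m)

theorem trans_μ (M N : LimMod A.alg) {X Y : B.Indexᵒᵖ} (t : X ⟶ Y)
    (z : (proj B.alg X).obj (D.obj M ⊗ D.obj N)) :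
    μ (pullback (D.map Y)) M N ((D.obj M ⊗ D.obj N).trans t z) =
      (D.obj (M ⊗ N)).trans t (μ (pullback (D.map X)) M N z) := by
  -- Both sides are recast as linear maps over `B_X`, with target restricted along `t`, so that they
  -- can be compared on tensors of images of sections.
  let f : (pullback (D.map X)).obj M ⊗ (pullback (D.map X)).obj N ⟶
      (ModuleCat.restrictScalars (B.alg.map t).hom.toRingHom).obj
        ((pullback (D.map Y)).obj (M ⊗ N)) :=
    (D.obj M ⊗ D.obj N).obj.map t ≫
      (ModuleCat.restrictScalars (B.alg.map t).hom.toRingHom).map (μ (pullback (D.map Y)) M N)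
  let f' : (pullback (D.map X)).obj M ⊗ (pullback (D.map X)).obj N ⟶
      (ModuleCat.restrictScalars (B.alg.map t).hom.toRingHom).obj
        ((pullback (D.map Y)).obj (M ⊗ N)) :=
    μ (pullback (D.map X)) M N ≫ (D.obj (M ⊗ N)).obj.map t
  suffices f = f' from congr($this z)
  rw [← cancel_epi (Functor.OplaxMonoidal.δ (pullback (D.map X)) M N)]
  refine ((ModuleCat.extendRestrictScalarsAdj (D.map X).hom.toRingHom).homEquiv _ _).injective
    (ModuleCat.MonoidalCategory.tensor_ext fun m n => ?_)
  obtain ⟨s, rfl⟩ := exists_ev M _ m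
  obtain ⟨r, rfl⟩ := exists_ev N _ n
  have h₁ : f ((image (pullback (D.map X)) s) ⊗ₜ[B.alg.obj X] (image (pullback (D.map X)) r)) =
      image (pullback (D.map Y)) (tensorSection s r) := by
    rw [image_tensorSection]
    exact congrArg₂ (fun x y => μ (pullback (D.map Y)) M N (x ⊗ₜ[B.alg.obj Y] y))
      (D.trans_image M t s) (D.trans_image N t r)
  have h₂ : f' ((image (pullback (D.map X)) s) ⊗ₜ[B.alg.obj X] (image (pullback (D.map X)) r)) =
      image (pullback (D.map Y)) (tensorSection s r) := by
    refine Eq.trans ?_ (D.trans_image (M ⊗ N) t (tensorSection s r))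
    exact congrArg ((D.obj (M ⊗ N)).trans t) (image_tensorSection (pullback (D.map X)) s r).symm
  exact h₁.trans h₂.symm

theorem trans_ε {X Y : B.Indexᵒᵖ} (t : X ⟶ Y) (r : B.alg.obj X) :
    ε (pullback (D.map Y)) ((B.alg.map t).hom r) =
      (D.obj (𝟙_ _)).trans t (ε (pullback (D.map X)) r) := by
  rw [ε_apply (pullback (D.map X)) r, ε_apply (pullback (D.map Y)), ← image_id, ← image_id]
  exact (D.semi_smul_image t r _).symm

noncomputable instance : D.functor.LaxMonoidal where
  ε := mkHom (M := 𝟙_ (LimMod B.alg)) (N := D.obj (𝟙_ _)) (fun X => ε (pullback (D.map X)))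
    (fun _ _ t r => D.trans_ε t r)
  μ M N := mkHom (M := D.obj M ⊗ D.obj N) (N := D.obj (M ⊗ N)) (fun X => μ (pullback (D.map X)) M N)
    (fun _ _ t z => D.trans_μ M N t z)
  μ_natural_left f N := hom_ext_apply fun X z =>
    congr($(μ_natural_left (pullback (D.map X)) f N) z)
  μ_natural_right N f := hom_ext_apply fun X z =>
    congr($(μ_natural_right (pullback (D.map X)) N f) z)
  associativity M N P := hom_ext_apply fun X z =>
    congr($(associativity (pullback (D.map X)) M N P) z)
  left_unitality M := hom_ext_apply fun X z =>
    congr($(left_unitality (pullback (D.map X)) M) z)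
  right_unitality M := hom_ext_apply fun X z =>
    congr($(right_unitality (pullback (D.map X)) M) z)

noncomputable instance : D.functor.LaxBraided where
  braided M N := hom_ext_apply fun X z =>
    congr($(Functor.LaxBraided.braided (F := pullback (D.map X)) M N) z)

/-- The functor `M ↦ (B_X ⊗ M_{a X})_X` as a tensor functor. -/
noncomputable def tensorFunctor : TensorFunctor K (LimMod A.alg) (LimMod B.alg) :=
  ⟨.of D.functor,
    (isIso_iff (ε D.functor)).2 fun X => inferInstanceAs (IsIso (ε (pullback (D.map X)))),
    fun M N => (isIso_iff (μ D.functor M N)).2 fun X =>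
      inferInstanceAs (IsIso (μ (pullback (D.map X)) M N)),
    { map_add := fun {_ _ f f'} => hom_ext_apply fun X m =>
        congr($((pullback (D.map X)).map_add (f := f) (g := f')) m) },
    { map_smul := fun f c => hom_ext_apply fun X m =>
        congr($(Functor.map_smul (F := pullback (D.map X)) c f) m) },
    preservesColimitsOfSize_of_proj D.functor fun X =>
      inferInstanceAs (PreservesColimitsOfSize.{u, u} (pullback (D.map X)))⟩

theorem isScalarHom_tensorFunctor (X : B.Indexᵒᵖ) :
    IsScalarHom (D.tensorFunctor.functor ⋙ proj B.alg X) (D.map X) :=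
  isScalarHom_pullback (D.map X)

end GluingData

/-- Choose a representative of each component of `φ`, with no monotonicity in the index. Adjacent
choices define the same scalars, which provides the transition isomorphisms; these preserve images
of sections, so the cocycle condition holds. -/
theorem exists_isProInverseImage (φ : A ⟶ B) :
    ∃ F : TensorFunctor K (LimMod A.alg) (LimMod B.alg), IsProInverseImage φ F.functor := by
  have hrep (j : B.Index) : ∃ (i : A.Index) (g : A.alg.obj (op i) ⟶ B.alg.obj (op j)),
      ColimHom.mk i g = ProHom.app φ j := by
    obtain ⟨⟨i, g⟩, h⟩ := Quotient.exists_rep (ProHom.app φ j)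
    exact ⟨i, g, h⟩
  choose i g hg using hrep
  have hscalar {X Y : B.Indexᵒᵖ} (t : X ⟶ Y) :
      IsScalarHom (pullback (g Y.unop)) (g X.unop ≫ B.alg.map t) := by
    refine HasScalars.isScalarHom (x := ProHom.app φ Y.unop) ?_ ?_
    · rw [← hg]
      exact (isScalarHom_pullback (g Y.unop)).hasScalars
    · rw [← ColimHom.mk_comp, hg]
      exact ProHom.app_comp φ t.unop.le
  choose E hE using fun (X Y : B.Indexᵒᵖ) (t : X ⟶ Y) => exists_transition_iso (hscalar t)
  let D : GluingData A B :=
    { index := fun X => op (i X.unop)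
      map := fun X => g X.unop
      iso := fun {X Y} t => E X Y t
      iso_image := fun {X Y} t => hE X Y t }
  refine ⟨D.tensorFunctor, (isProInverseImage_iff φ _).2 fun j => ?_⟩
  have := (D.isScalarHom_tensorFunctor (op j)).hasScalars
  rwa [← hg]

end LimMod

/-! ### Tensoriality and full faithfulness -/

theorem CategoryTheory.Discrete.isEquivalence_functor {T : Type*} {C : Type*} [Category* C]
    (Φ : T → C) (h₁ : ∀ X Y : C, Subsingleton (X ⟶ Y)) (h₂ : ∀ x y, (Φ x ⟶ Φ y) → x = y)
    (h₃ : ∀ X : C, ∃ x, Nonempty (Φ x ≅ X)) : (Discrete.functor Φ).IsEquivalence where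
  faithful := { map_injective := fun _ => Subsingleton.elim _ _ }
  full := { map_surjective := fun f => ⟨eqToHom (Discrete.ext (h₂ _ _ f)),
    (h₁ _ _).elim _ _⟩ }
  essSurj := { mem_essImage := fun X => (h₃ X).elim fun x e => ⟨⟨x⟩, e⟩ }

namespace LimMod

open Functor.LaxMonoidal

variable {K : Type u} [CommRing K] {A B : AcceptableProAlgebra K} {S : CommAlgCat.{u} K}

section

variable {C D : Type (u + 1)} [Category.{u} C] [MonoidalCategory C]
  [SymmetricCategory C] [Preadditive C] [Linear K C] [Category.{u} D] [MonoidalCategory D]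
  [SymmetricCategory D] [Preadditive D] [Linear K D]

/-- The natural transformation underlying a morphism of tensor functors. -/
def natTrans {F G : TensorFunctor K C D} (η : F ⟶ G) : F.functor ⟶ G.functor := η.hom.hom.hom

instance {F G : TensorFunctor K C D} (η : F ⟶ G) : NatTrans.IsMonoidal (natTrans η) :=
  η.hom.hom.isMonoidal

theorem tensorFunctor_hom_ext {F G : TensorFunctor K C D} {η η' : F ⟶ G}
    (h : natTrans η = natTrans η') : η = η' :=
  ObjectProperty.hom_ext _ (LaxBraidedFunctor.hom_ext h)

/-- An isomorphism of tensor functors given by a monoidal natural isomorphism. -/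
def tensorFunctorIso {F G : TensorFunctor K C D} (e : F.functor ≅ G.functor)
    [NatTrans.IsMonoidal e.hom] : F ≅ G :=
  ObjectProperty.isoMk _ (LaxBraidedFunctor.isoMk e)

end

instance (F G : TensorFunctor K (LimMod A.alg) (ModuleCat.{u} S)) : Subsingleton (F ⟶ G) where
  allEq _ _ := tensorFunctor_hom_ext (app_eq_of_isMonoidal _ _)

theorem isTensorial (A : AcceptableProAlgebra K) : IsTensorial A.alg := by
  refine fun S => ⟨exists_isInverseImage, fun Φ hΦ => ?_⟩
  refine Discrete.isEquivalence_functor Φ inferInstance (fun x y η => ?_) fun G => ?_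
  · have hx := (isInverseImage_iff _).1 (hΦ x)
    have hy := (isInverseImage_iff _).1 (hΦ y)
    exact (hx.of_isMonoidal (natTrans η)).unique hy
  · obtain ⟨⟨i, g⟩, hx⟩ := exists_hasScalars G.functor
    obtain ⟨D⟩ := hΦ (ColimHom.mk i g)
    obtain ⟨D'⟩ := (isInverseImage_iff G.functor).2 hx
    have h₁ := D.isMonoidal i g rfl
    have h₂ := D'.isMonoidal i g rfl
    let e := (D.iso i g rfl).symm ≪≫ D'.iso i g rfl
    have : NatTrans.IsMonoidal e.hom :=
      inferInstanceAs (NatTrans.IsMonoidal ((D.iso i g rfl).inv ≫ (D'.iso i g rfl).hom))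
    exact ⟨_, ⟨tensorFunctorIso e⟩⟩

instance (F G : TensorFunctor K (LimMod A.alg) (LimMod B.alg)) : Subsingleton (F ⟶ G) where
  allEq η η' := by
    refine tensorFunctor_hom_ext (NatTrans.ext (funext fun M => hom_ext_apply fun X m => ?_))
    have h := app_eq_of_isMonoidal (Functor.whiskerRight (natTrans η) (proj B.alg X))
      (Functor.whiskerRight (natTrans η') (proj B.alg X))
    exact congr(($h).app M m)

/-- No compatibility between the `e X` is required: both composites with a transition map agree on
images of sections, hence everywhere. -/
theorem nonempty_iso {F G : TensorFunctor K (LimMod A.alg) (LimMod B.alg)}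
    (e : ∀ X : B.Indexᵒᵖ, F.functor ⋙ proj B.alg X ≅ G.functor ⋙ proj B.alg X)
    (he : ∀ X, NatTrans.IsMonoidal (e X).hom) : Nonempty (F ≅ G) := by
  have hcompat (M : LimMod A.alg) {X Y : B.Indexᵒᵖ} (t : X ⟶ Y)
      (m : (F.functor ⋙ proj B.alg X).obj M) :
      (e Y).hom.app M ((F.functor.obj M).trans t m) =
        (G.functor.obj M).trans t ((e X).hom.app M m) := by
    refine image_induction (F.functor ⋙ proj B.alg X) (fun m =>
      (e Y).hom.app M ((F.functor.obj M).trans t m) =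
        (G.functor.obj M).trans t ((e X).hom.app M m)) ?_ ?_ ?_ m
    · rw [trans_zero]
      refine (map_zero ((e Y).hom.app M).hom).trans ?_
      exact (trans_zero _ t).symm.trans (congrArg _ (map_zero ((e X).hom.app M).hom).symm)
    · intro x y hx hy
      refine (congrArg ((e Y).hom.app M) (trans_add _ t x y)).trans ?_
      refine (map_add ((e Y).hom.app M).hom _ _).trans ((congrArg₂ (· + ·) hx hy).trans ?_)
      exact (trans_add _ t _ _).symm.trans (congrArg _ (map_add ((e X).hom.app M).hom x y).symm)
    · intro c s
      refine (congrArg ((e Y).hom.app M) (trans_smul _ t c _)).trans ?_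
      refine (map_smul ((e Y).hom.app M).hom ((B.alg.map t).hom c) _).trans ?_
      refine Eq.trans ?_ (congrArg _ (map_smul ((e X).hom.app M).hom c _).symm)
      refine Eq.trans ?_ (trans_smul _ t c _).symm
      refine congrArg ((B.alg.map t).hom c • ·) ?_
      refine (congrArg ((e Y).hom.app M) (trans_image F.functor t s)).trans ?_
      refine (app_image (e Y).hom s).trans ((trans_image G.functor t s).symm.trans ?_)
      exact congrArg _ (app_image (e X).hom s).symm
  let η : F.functor ⟶ G.functor :=
    { app M := mkHom (fun X => (e X).hom.app M) fun X Y t m => hcompat M t m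
      naturality M N f := hom_ext_apply fun X m => congr($((e X).hom.naturality f) m) }
  have (M : LimMod A.alg) : IsIso (η.app M) := (isIso_iff _).2 fun X =>
    inferInstanceAs (IsIso ((e X).hom.app M))
  have : IsIso η := NatIso.isIso_of_isIso_app η
  have : NatTrans.IsMonoidal (asIso η).hom :=
    { unit := hom_ext_apply fun X m => congr($((he X).unit) m)
      tensor M N := hom_ext_apply fun X m => congr($((he X).tensor M N) m) }
  exact ⟨tensorFunctorIso (asIso η)⟩

theorem isEquivalence_of_isProInverseImage
    (Φ : (A ⟶ B) → TensorFunctor K (LimMod A.alg) (LimMod B.alg))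
    (hΦ : ∀ φ, IsProInverseImage φ (Φ φ).functor) : (Discrete.functor Φ).IsEquivalence := by
  refine Discrete.isEquivalence_functor Φ inferInstance (fun φ ψ η => ?_) fun F => ?_
  · have hφ := (isProInverseImage_iff _ _).1 (hΦ φ)
    have hψ := (isProInverseImage_iff _ _).1 (hΦ ψ)
    exact ProHom.ext (funext fun j => HasScalars.unique ((hφ j).of_isMonoidal
      (Functor.whiskerRight (natTrans η) (proj B.alg (op j)))) (hψ j))
  · choose x hx using fun j => exists_hasScalars (F.functor ⋙ proj B.alg (op j))
    -- The components `x j` form a morphism of pro-algebras because pushing `x j'` to `B_j` gives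
    -- scalars for the `j`-th component of `F`, and scalars determine the element of the colimit.
    let φ : A ⟶ B := ProHom.mk x fun {j j'} h => by
      refine HasScalars.unique (G := F.functor ⋙ proj B.alg (op j)) (fun a => ?_) (hx j)
      rw [scalar_comp, HasScalar, ← trans_image F.functor (homOfLE h).op a, hx j' a]
      refine (trans_smul _ _ _ _).trans (congrArg (_ • ·) ?_)
      rw [← image_id, ← image_id]
      exact trans_image F.functor _ _
    have hF : IsProInverseImage φ F.functor := (isProInverseImage_iff _ _).2 hx
    obtain ⟨D, -⟩ := hΦ φ
    obtain ⟨D', -⟩ := hF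
    have key (X : B.Indexᵒᵖ) : ∃ e : (Φ φ).functor ⋙ proj B.alg X ≅ F.functor ⋙ proj B.alg X,
        NatTrans.IsMonoidal e.hom := by
      obtain ⟨⟨i, g⟩, hg⟩ := Quotient.exists_rep (x X.unop)
      have h₁ := (D X.unop).isMonoidal i g hg
      have h₂ := (D' X.unop).isMonoidal i g hg
      exact ⟨((D X.unop).iso i g hg).symm ≪≫ (D' X.unop).iso i g hg,
        inferInstanceAs (NatTrans.IsMonoidal
          (((D X.unop).iso i g hg).inv ≫ ((D' X.unop).iso i g hg).hom))⟩
    choose e he using key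
    exact ⟨φ, nonempty_iso e he⟩

end LimMod

theorem mainTheorem8 (K : Type u) [CommRing K] :
    -- `{A_i} ↦ lim_i M_{A_i}` takes values in symmetric monoidal locally presentable categories
    (∀ A : AcceptableProAlgebra K, IsTensorLocallyPresentable K (LimMod A.alg)) ∧
    -- it acts on morphisms by inverse image functors
    (∀ (A B : AcceptableProAlgebra K) (φ : A ⟶ B),
      ∃ F : TensorFunctor K (LimMod A.alg) (LimMod B.alg), IsProInverseImage φ F.functor) ∧
    -- compatibly with identities and composition
    (∀ A : AcceptableProAlgebra K, IsProInverseImage (𝟙 A) (𝟭 (LimMod A.alg))) ∧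
    (∀ (A B C : AcceptableProAlgebra K) (φ : A ⟶ B) (ψ : B ⟶ C)
      (F : TensorFunctor K (LimMod A.alg) (LimMod B.alg))
      (G : TensorFunctor K (LimMod B.alg) (LimMod C.alg)),
      IsProInverseImage φ F.functor → IsProInverseImage ψ G.functor →
        IsProInverseImage (φ ≫ ψ) (F.functor ⋙ G.functor)) ∧
    -- and is fully faithful
    (∀ (A B : AcceptableProAlgebra K)
      (Φ : (A ⟶ B) → TensorFunctor K (LimMod A.alg) (LimMod B.alg)),
      (∀ φ, IsProInverseImage φ (Φ φ).functor) → (Discrete.functor Φ).IsEquivalence) ∧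
    -- affine ind-schemes indexed by countable posets are 2-affine
    (∀ A : AcceptableProAlgebra K, IsTensorial A.alg) :=
  ⟨LimMod.isTensorLocallyPresentable, fun _ _ => LimMod.exists_isProInverseImage,
    LimMod.isProInverseImage_id, fun _ _ _ _ _ _ _ => LimMod.IsProInverseImage.comp,
    fun _ _ => LimMod.isEquivalence_of_isProInverseImage, LimMod.isTensorial⟩
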